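/- Let $q$ be a prime power, let $\Delta$ be a positive integer, and let $a$ be the largest integer such that $q^a$ divides $\Delta$. A linear code $C\subseteq\mathbb{F}_q^n$ is called $\Delta$-divisible if the Hamming weight of every codeword is divisible by $\Delta$. Two linear codes of the same length are isomorphic if one is mapped onto the other by a semimonomial transformation (a permutation of the positions, multiplication of the positions by non-zero scalars, and a field automorphism of $\mathbb{F}_q$ applied to all entries). The $m$-fold repetition of a code repeats every position $m$ times. Let $C$ be a $\Delta$-divisible linear code over $\mathbb{F}_q$ which is spanned, as an $\mathbb{F}_q$-vector space, by its codewords of weight $\Delta$. Then $C$ is isomorphic to a (possibly empty) direct sum of codes of the following form, possibly extended by zero positions. (i) The $\frac{\Delta}{q^{k-1}}$-fold repetition of the $q$-ary simplex code of dimension $k\in\{1,\dots,a+1\}$, i.e. of the code generated by a matrix whose columns are representatives of all points of the projective space of $\mathbb{F}_q^k$, one column for each point. If $q=2$, additionally: (ii) The $\frac{\Delta}{2^{k-2}}$-fold repetition of the binary first order Reed–Muller code of dimension $k\in\{3,\dots,a+2\}$, i.e. of the code generated by the matrix whose columns are all vectors of $\mathbb{F}_2^{k-1}$, each extended by an entry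 $1$. (iii) If $a\ge 1$: the $\frac{\Delta}{2}$-fold repetition of the binary parity check code of dimension $k\ge 4$, i.e. of the code $\{c\in\mathbb{F}_2^{k+1} : c_1+\dots+c_{k+1}=0\}$. Moreover, the choice of the codes is uniquely determined by $C$ up to order: in any two such decompositions of $C$, the families and dimensions $k$ of the summands agree, with multiplicities, up to a permutation of the summands. -/

import Mathlib

namespace DivisibleCodes

universe u

/-! A linear code with position set `ι` over the field `F` is a subspace of `ι → F`;
codes of length `n` are the case `ι = Fin n`. -/

/-- All weights of codewords are divisible by `Δ`. -/
def IsDivisible {F : Type u} [Field F] [DecidableEq F] {ι : Type*} [Fintype ι]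
    (Δ : ℕ) (C : Submodule F (ι → F)) : Prop :=
  ∀ c ∈ C, Δ ∣ hammingNorm c

/-- The code is spanned by its codewords of weight `Δ`. -/
def IsSpannedByWeight {F : Type u} [Field F] [DecidableEq F] {ι : Type*} [Fintype ι]
    (Δ : ℕ) (C : Submodule F (ι → F)) : Prop :=
  Submodule.span F {c : ι → F | c ∈ C ∧ hammingNorm c = Δ} = C

/-- Isomorphism of linear codes: some semimonomial transformation (a permutation `e` of the
positions, non-zero scalars `u i`, and a field automorphism `σ`) maps `C` onto `C'`. -/
def CodeIso {F : Type u} [Field F] {ι κ : Type*}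
    (C : Submodule F (ι → F)) (C' : Submodule F (κ → F)) : Prop :=
  ∃ (e : ι ≃ κ) (u : ι → Fˣ) (σ : F ≃+* F),
    ∀ c' : κ → F, c' ∈ C' ↔ ∃ c ∈ C, ∀ i, c' (e i) = u i * σ (c i)

/-- The `m`-fold repetition of a code: each position is repeated `m` times. -/
def repetition {F : Type u} [Field F] {ι : Type*} (m : ℕ) (C : Submodule F (ι → F)) :
    Submodule F (ι × Fin m → F) :=
  C.map (LinearMap.funLeft F F Prod.fst)

/-- The direct sum of a family of codes: the words whose `i`-th component lies in `C i`. -/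
def directSum {F : Type u} [Field F] {s : ℕ} {ι : Fin s → Type*}
    (C : ∀ i, Submodule F (ι i → F)) : Submodule F ((Σ i, ι i) → F) :=
  ⨅ i, (C i).comap (LinearMap.funLeft F F (Sigma.mk i))

/-- The extension of a code by `z` zero positions. -/
def extendByZeros {F : Type u} [Field F] {ι : Type*} (z : ℕ) (C : Submodule F (ι → F)) :
    Submodule F (ι ⊕ Fin z → F) :=
  C.comap (LinearMap.funLeft F F Sum.inl) ⊓ LinearMap.ker (LinearMap.funLeft F F Sum.inr)

/-- The row space of a generator matrix. -/
def rowSpace {F : Type u} [Field F] {κ ι : Type*} (G : Matrix κ ι F) : Submodule F (ι → F) :=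
  Submodule.span F (Set.range G.row)

/-- The simplex code of dimension `k`: the columns of the generator matrix are representatives
of the points of the projective space of `F ^ k`. -/
noncomputable def simplexCode (F : Type u) [Field F] (k : ℕ) :
    Submodule F (Projectivization F (Fin k → F) → F) :=
  rowSpace (Matrix.of fun (i : Fin k) (p : Projectivization F (Fin k → F)) => p.rep i)

/-- The first order Reed-Muller code of dimension `k ≥ 2`: the columns of the generator matrix
are all vectors of `F ^ (k - 1)`, extended by an entry `1`. -/
def reedMullerCode (F : Type u) [Field F] (k : ℕ) :
    Submodule F ((Fin (k - 1) → F) → F) :=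
  rowSpace (Matrix.fromRows
    (Matrix.of fun (i : Fin (k - 1)) (v : Fin (k - 1) → F) => v i)
    (Matrix.of fun (_ : Unit) (_ : Fin (k - 1) → F) => (1 : F)))

/-- The parity check code of dimension `k`: all words of length `k + 1` with coordinate sum `0`.
(`ULift` only adjusts the universe of the set of positions.) -/
def parityCheckCode (F : Type u) [Field F] (k : ℕ) :
    Submodule F (ULift.{u} (Fin (k + 1)) → F) where
  carrier := {c | ∑ i, c i = 0}
  add_mem' := by
    intro x y hx hy
    simp only [Set.mem_ofPred_eq, Pi.add_apply, Finset.sum_add_distrib] at *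
    rw [hx, hy, add_zero]
  zero_mem' := by simp
  smul_mem' := by
    intro t x hx
    simp only [Set.mem_ofPred_eq, Pi.smul_apply, ← Finset.smul_sum] at *
    rw [hx, smul_zero]

/-- Names for the building blocks; the argument is the dimension. -/
inductive Block : Type
  | simplex (k : ℕ)
  | reedMuller (k : ℕ)
  | parityCheck (k : ℕ)

/-- The blocks that occur for given `q`, `Δ` and `a`, the largest integer with `q ^ a ∣ Δ`. -/
def Block.IsAdmissible (q a : ℕ) : Block → Prop
  | .simplex k => 1 ≤ k ∧ k ≤ a + 1
  | .reedMuller k => q = 2 ∧ 3 ≤ k ∧ k ≤ a + 2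
  | .parityCheck k => q = 2 ∧ 1 ≤ a ∧ 4 ≤ k

/-- The number of repetitions of a block. For admissible blocks the divisions are exact. -/
def Block.repetitions (q Δ : ℕ) : Block → ℕ
  | .simplex k => Δ / q ^ (k - 1)
  | .reedMuller k => Δ / 2 ^ (k - 2)
  | .parityCheck _ => Δ / 2

/-- The positions of the (unrepeated) code named by a block. -/
def Block.Pos (F : Type u) [Field F] : Block → Type u
  | .simplex k => Projectivization F (Fin k → F)
  | .reedMuller k => Fin (k - 1) → F
  | .parityCheck k => ULift.{u} (Fin (k + 1))

/-- The (unrepeated) code named by a block. -/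
noncomputable def Block.baseCode (F : Type u) [Field F] :
    (b : Block) → Submodule F (b.Pos F → F)
  | .simplex k => simplexCode F k
  | .reedMuller k => reedMullerCode F k
  | .parityCheck k => parityCheckCode F k

/-- The suitably repeated code named by a block, over the finite field `F`. -/
noncomputable def Block.code (F : Type u) [Field F] [Fintype F] (Δ : ℕ) (b : Block) :
    Submodule F (b.Pos F × Fin (b.repetitions (Fintype.card F) Δ) → F) :=
  repetition (b.repetitions (Fintype.card F) Δ) (b.baseCode F)

/-- `C` is isomorphic to the direct sum of the codes named by `b 0, …, b (s - 1)`, possibly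
extended by zero positions. -/
def IsDirectSumOfBlocks {F : Type u} [Field F] [Fintype F] {ι : Type*}
    (Δ : ℕ) (C : Submodule F (ι → F)) {s : ℕ} (b : Fin s → Block) : Prop :=
  ∃ z : ℕ, CodeIso C (extendByZeros z (directSum fun i => (b i).code F Δ))

end DivisibleCodes

/-!
The weight function of a code determines it up to a monomial transformation and zero positions: this
is the extension theorem of MacWilliams (`exists_monomial_of_wt_eq`), proved by counting, for every
hyperplane of the code, the columns that do not vanish on it. So it suffices to understand the given
code `C` as a vector space with a weight function.

The key observation (`wt_of_overlapping`) concerns two linearly independent words `x`, `y` of weight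
`Δ` with overlapping supports. Divisibility by `Δ` leaves a single possibility: all `x - t • y` have
weight `Δ`, and the common support has size `(q - 1) / q * Δ`. Consider the graph on the words of
weight `Δ` in which overlapping words are adjacent. The spans of its connected components have
disjoint supports, and `C` is their direct sum (`exists_connected_decomposition`).

It remains to recognize a connected code (`exists_isBlockCopy_of_isConnectedCode`). If overlapping
is a transitive relation, all nonzero words have weight `Δ`, and the code is a repeated simplex
code. For `q > 2` this is always the case, as two disjoint parts of relative size `(q - 1) / q` do
not fit into one word. For `q = 2` a path `x`, `y`, `z` with `x` and `z` disjoint gives four disjoint words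
of weight `Δ / 2` whose pairwise sums lie in the code. Take a maximal such frame. A word of weight
`Δ` that meets the frame is a sum of two of its members, unless the frame has exactly four members
and covers the word (`IsFrame.cases_of_maximal`). By connectedness the code is then a repeated
parity check code, if the frame has at least five members, or it consists of words covered by the
frame, and is a repeated first order Reed-Muller code.

For the uniqueness, each word `v` of weight `Δ` gets a type computed from the weight function alone:
the size of the group generated by the words of weight `Δ` overlapping `v`, and whether none,
one, or more of its nonzero members have a weight other than `Δ`. The type is the same for all words of weight `Δ` in a
building block and determines the block (`Block.wordType_code`, `Block.type_injective`), and the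
numbers of words of a given type add up in direct sums (`typeCount_pi`). So the number of summands
equal to a given block can be read off from the code.
-/

namespace DivisibleCodes

universe u

/-! ### Hamming weight -/

/-- The Hamming weight of a word, as the cardinality of its support. Unlike `hammingNorm` it needs
neither decidability nor an enumeration of the positions. -/
noncomputable def wt {F ι : Type*} [Field F] (c : ι → F) : ℕ := (Function.support c).ncard

section Weight

variable {F ι κ : Type*} [Field F]

lemma wt_eq_hammingNorm [Fintype ι] [DecidableEq F] (c : ι → F) : wt c = hammingNorm c := by
  rw [wt, hammingNorm, ← Set.ncard_coe_finset]
  congr 1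
  ext i
  simp

@[simp] lemma wt_zero : wt (0 : ι → F) = 0 := by simp [wt]

lemma wt_eq_natCard (c : ι → F) : wt c = Nat.card {i // c i ≠ 0} := rfl

lemma eq_zero_of_mul_self_eq_zero {c : ι → F} (h : c * c = 0) : c = 0 :=
  funext fun i => mul_self_eq_zero.1 (congrFun h i)

lemma wt_congr (e : ι ≃ κ) (c : ι → F) (d : κ → F) (h : ∀ i, c i ≠ 0 ↔ d (e i) ≠ 0) :
    wt c = wt d := by
  rw [wt_eq_natCard, wt_eq_natCard]
  exact Nat.card_congr (e.subtypeEquiv h)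

lemma wt_smul {t : F} (ht : t ≠ 0) (c : ι → F) : wt (t • c) = wt c :=
  wt_congr (Equiv.refl _) _ _ fun i => by simp [ht]

variable [Finite ι]

lemma wt_eq_zero {c : ι → F} : wt c = 0 ↔ c = 0 := by
  rw [wt, Set.ncard_eq_zero (Set.toFinite _), Function.support_eq_empty_iff]

lemma wt_pos {c : ι → F} : 0 < wt c ↔ c ≠ 0 := by
  rw [Nat.pos_iff_ne_zero, Ne, wt_eq_zero]

lemma wt_add_of_mul_eq_zero {x y : ι → F} (h : x * y = 0) : wt (x + y) = wt x + wt y := by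
  have h' : ∀ i, x i = 0 ∨ y i = 0 := fun i => mul_eq_zero.1 (congrFun h i)
  rw [wt, wt, wt, ← Set.ncard_union_eq _ (Set.toFinite _) (Set.toFinite _)]
  · congr 1
    ext i
    rcases h' i with h0 | h0 <;> simp [h0]
  · rw [Set.disjoint_left]
    intro i hi hi'
    rcases h' i with h0 | h0
    · exact hi h0
    · exact hi' h0

lemma wt_sum_of_mul_eq_zero {J : Type*} (s : Finset J) (f : J → ι → F)
    (h : ∀ i ∈ s, ∀ j ∈ s, i ≠ j → f i * f j = 0) :
    wt (∑ i ∈ s, f i) = ∑ i ∈ s, wt (f i) := by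
  classical
  induction s using Finset.induction_on with
  | empty => simp
  | insert a s ha ih =>
    rw [Finset.sum_insert ha, Finset.sum_insert ha, wt_add_of_mul_eq_zero, ih]
    · intro i hi j hj
      exact h i (Finset.mem_insert_of_mem hi) j (Finset.mem_insert_of_mem hj)
    · rw [Finset.mul_sum]
      refine Finset.sum_eq_zero fun j hj => ?_
      refine h a (Finset.mem_insert_self _ _) j (Finset.mem_insert_of_mem hj) ?_
      rintro rfl
      exact ha hj

lemma wt_mul_le (x y : ι → F) : wt (x * y) ≤ wt x :=
  Set.ncard_le_ncard (fun i hi => by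
    simp only [Function.mem_support, Pi.mul_apply] at hi ⊢
    exact left_ne_zero_of_mul hi) (Set.toFinite _)

lemma support_subset_of_wt_mul_eq {x y : ι → F} (h : wt x ≤ wt (x * y)) {i : ι} (hi : x i ≠ 0) :
    y i ≠ 0 := by
  have h1 : Function.support (x * y) ⊆ Function.support x := fun i hi => by
    simp only [Function.mem_support, Pi.mul_apply] at hi ⊢
    exact left_ne_zero_of_mul hi
  have h2 := Set.eq_of_subset_of_ncard_le h1 h (Set.toFinite _)
  have h3 : i ∈ Function.support (x * y) := by rw [h2]; exact hi
  exact right_ne_zero_of_mul (Function.mem_support.1 h3)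

end Weight

/-! ### Counting with linear functionals -/

lemma natCard_subtype_eq_add {α : Type*} [Finite α] {p r s : α → Prop} (h : ∀ a, p a ↔ r a ∨ s a)
    (hd : ∀ a, r a → ¬ s a) : Nat.card {a // p a} = Nat.card {a // r a} + Nat.card {a // s a} := by
  change Set.ncard {a | p a} = Set.ncard {a | r a} + Set.ncard {a | s a}
  have hd' : Disjoint {a | r a} {a | s a} := Set.disjoint_left.2 hd
  rw [← Set.ncard_union_eq hd' (Set.toFinite _) (Set.toFinite _)]
  congr 1
  ext a
  exact h a

lemma natCard_add_natCard_not {α : Type*} [Finite α] (p : α → Prop) :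
    Nat.card {a // p a} + Nat.card {a // ¬ p a} = Nat.card α := by
  classical
  rw [← Nat.card_sum]
  exact Nat.card_congr (Equiv.sumCompl _)

section Counting

variable {F : Type*} [Field F] [Fintype F]

lemma natCard_fiber_mul_card {V : Type*} [AddCommGroup V] [Module F V]
    (f : V →ₗ[F] F) (hf : f ≠ 0) (t : F) :
    Nat.card {v // f v = t} * Fintype.card F = Nat.card V := by
  have hs : Function.Surjective f := LinearMap.surjective hf
  obtain ⟨v₀, rfl⟩ := hs t
  have e : {v // f v = f v₀} ≃ LinearMap.ker f :=
    { toFun := fun v => ⟨v.1 - v₀, by simp [v.2]⟩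
      invFun := fun w => ⟨w.1 + v₀, by simp [LinearMap.mem_ker.1 w.2]⟩
      left_inv := fun v => by simp
      right_inv := fun w => by simp }
  rw [Nat.card_congr e, Submodule.card_eq_card_quotient_mul_card (LinearMap.ker f),
    Nat.card_congr (f.quotKerEquivOfSurjective hs).toEquiv, Nat.card_eq_fintype_card (α := F)]

lemma natCard_ne_zero_mul_card {V : Type*} [AddCommGroup V] [Module F V] [Finite V]
    (f : V →ₗ[F] F) (hf : f ≠ 0) :
    Nat.card {v // f v ≠ 0} * Fintype.card F = (Fintype.card F - 1) * Nat.card V := by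
  classical
  have := Fintype.ofFinite V
  have h1 := natCard_fiber_mul_card f hf 0
  have h2 : Nat.card {v // f v = 0} + Nat.card {v // f v ≠ 0} = Nat.card V :=
    natCard_add_natCard_not _
  have h3 : 1 ≤ Fintype.card F := Fintype.card_pos
  obtain ⟨r, hr⟩ := Nat.exists_eq_add_of_le h3
  rw [hr] at h1 ⊢
  simp only [Nat.add_sub_cancel_left]
  rw [← h2] at h1 ⊢
  linarith

/-- The total weight of a code, computed column by column. -/
lemma sum_wt_mul_card {V ι : Type*} [AddCommGroup V] [Module F V] [Fintype V] [Finite ι]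
    (f : V →ₗ[F] (ι → F)) :
    (∑ v, wt (f v)) * Fintype.card F
      = (Fintype.card F - 1) * Nat.card V * Nat.card {i // ∃ v, f v i ≠ 0} := by
  classical
  have := Fintype.ofFinite ι
  have h1 : ∑ v, wt (f v) = ∑ i, Nat.card {v // f v i ≠ 0} := by
    simp only [wt_eq_natCard, Nat.card_eq_fintype_card, Fintype.card_subtype, Finset.card_filter]
    exact Finset.sum_comm
  have h2 : ∀ i, Nat.card {v // f v i ≠ 0} * Fintype.card F
      = if ∃ v, f v i ≠ 0 then (Fintype.card F - 1) * Nat.card V else 0 := by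
    intro i
    split_ifs with h
    · refine natCard_ne_zero_mul_card (LinearMap.proj i ∘ₗ f) fun h0 => ?_
      obtain ⟨v, hv⟩ := h
      exact hv (LinearMap.congr_fun h0 v)
    · have : IsEmpty {v // f v i ≠ 0} := ⟨fun v => h ⟨v.1, v.2⟩⟩
      simp
  rw [h1, Finset.sum_mul, Finset.sum_congr rfl fun i _ => h2 i, Finset.sum_ite,
    Finset.sum_const_zero, add_zero, Finset.sum_const, smul_eq_mul, mul_comm,
    Nat.card_eq_fintype_card (α := {i // _}), Fintype.card_subtype]

/-- A code with `q ^ k` words all of whose nonzero words have weight `Δ` forces `q ^ (k - 1) ∣ Δ`: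
the total weight `(q ^ k - 1) * Δ` is a multiple of `q ^ (k - 1)`. -/
lemma pow_dvd_of_constant_weight {ι : Type*} [Finite ι] (V : Submodule F (ι → F)) {Δ k : ℕ}
    (hc : ∀ v ∈ V, v ≠ 0 → wt v = Δ) (hk : 1 ≤ k) (hV : Nat.card V = Fintype.card F ^ k) :
    Fintype.card F ^ (k - 1) ∣ Δ := by
  classical
  have := Fintype.ofFinite V
  set q := Fintype.card F with hq
  have hq1 : 1 ≤ q := Fintype.card_pos
  have h1 := sum_wt_mul_card V.subtype
  have h2 : ∑ v : V, wt (V.subtype v) = (q ^ k - 1) * Δ := by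
    rw [← Finset.add_sum_erase _ _ (Finset.mem_univ (0 : V)),
      Finset.sum_congr rfl (g := fun _ => Δ)]
    · simp [Finset.card_erase_of_mem, ← Nat.card_eq_fintype_card, hV]
    · intro v hv
      exact hc v v.2 (by simpa using (Finset.mem_erase.1 hv).1)
  obtain ⟨m, rfl⟩ := Nat.exists_eq_add_of_le' hk
  rw [h2, hV, ← hq, pow_succ] at h1
  have h3 : (q ^ m * q - 1) * Δ
      = q ^ m * ((q - 1) * Nat.card {i // ∃ v : V, V.subtype v i ≠ 0}) := by
    refine Nat.eq_of_mul_eq_mul_right hq1 ?_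
    linarith
  have h4 : Nat.Coprime (q ^ m) (q ^ m * q - 1) := by
    have h5 : 1 ≤ q ^ m * q := Nat.mul_pos (pow_pos hq1 _) hq1
    have h6 : Nat.Coprime (q ^ m * q) (q ^ m * q - 1) :=
      (Nat.coprime_self_sub_right h5).2 (Nat.coprime_one_right _)
    exact h6.coprime_dvd_left (Dvd.intro _ rfl)
  exact h4.dvd_of_dvd_mul_left ⟨_, h3⟩

end Counting

/-! ### The extension theorem of MacWilliams -/

lemma exists_equiv_of_natCard_fiber_eq {α β γ : Type*} [Finite α] [Finite β] (f : α → γ)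
    (g : β → γ) (h : ∀ c, Nat.card {a // f a = c} = Nat.card {b // g b = c}) :
    ∃ e : α ≃ β, ∀ a, g (e a) = f a := by
  have e : ∀ c, Nonempty ({a // f a = c} ≃ {b // g b = c}) := fun c =>
    Finite.card_eq.1 (h c)
  exact ⟨Equiv.ofFiberEquiv fun c => (e c).some, fun a => Equiv.ofFiberEquiv_map _ a⟩

section Extension

variable {F : Type*} [Field F] [Fintype F] {V ι κ : Type*} [AddCommGroup V] [Module F V] [Finite V]
  [Finite ι] [Finite κ]

/-- Codes with the same weight function have equally many nonzero positions. -/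
lemma natCard_nonzero_positions_eq (f : V →ₗ[F] (ι → F)) (g : V →ₗ[F] (κ → F))
    (h : ∀ v, wt (f v) = wt (g v)) :
    Nat.card {i // ∃ v, f v i ≠ 0} = Nat.card {j // ∃ v, g v j ≠ 0} := by
  have := Fintype.ofFinite V
  have h1 := sum_wt_mul_card f
  have h2 := sum_wt_mul_card g
  simp only [h] at h1
  rw [h1] at h2
  refine Nat.eq_of_mul_eq_mul_left ?_ h2
  have := Fintype.one_lt_card (α := F)
  exact Nat.mul_pos (by omega) Nat.card_pos

/-- For a functional `γ`, the codes restricted to `ker γ` determine the number of columns that are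
not multiples of `γ`. -/
lemma natCard_not_multiple_eq (f : V →ₗ[F] (ι → F)) (g : V →ₗ[F] (κ → F))
    (h : ∀ v, wt (f v) = wt (g v)) (γ : V →ₗ[F] F) :
    Nat.card {i // ¬ ∃ t : F, LinearMap.proj i ∘ₗ f = t • γ}
      = Nat.card {j // ¬ ∃ t : F, LinearMap.proj j ∘ₗ g = t • γ} := by
  have key : ∀ φ : V →ₗ[F] F, (¬ ∃ t : F, φ = t • γ) ↔ ∃ v : LinearMap.ker γ, φ v ≠ 0 := by
    intro φ
    constructor
    · intro hφ
      by_contra! h0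
      have h1 : φ ∈ Submodule.span F (Set.range fun _ : Unit => γ) := by
        refine mem_span_of_iInf_ker_le_ker (ι := Unit) ?_
        intro v hv
        have hv' : v ∈ LinearMap.ker γ := by simpa using hv
        exact h0 ⟨v, hv'⟩
      rw [Set.range_const, Submodule.mem_span_singleton] at h1
      obtain ⟨t, ht⟩ := h1
      exact hφ ⟨t, ht.symm⟩
    · rintro ⟨v, hv⟩ ⟨t, rfl⟩
      exact hv (by simp [LinearMap.mem_ker.1 v.2])
  have h1 := natCard_nonzero_positions_eq (f ∘ₗ (LinearMap.ker γ).subtype)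
    (g ∘ₗ (LinearMap.ker γ).subtype) fun v => h v
  simp only [key]
  exact h1

/-- **Extension theorem of MacWilliams**: two parametrizations of codes of the same length by the
same space with the same weight function differ by a monomial transformation. -/
theorem exists_monomial_of_wt_eq (f : V →ₗ[F] (ι → F)) (g : V →ₗ[F] (κ → F))
    (h : ∀ v, wt (f v) = wt (g v)) (hcard : Nat.card ι = Nat.card κ) :
    ∃ (e : ι ≃ κ) (u : ι → Fˣ), ∀ v i, g v (e i) = u i * f v i := by
  classical
  -- Two functionals are in the same class if they are nonzero multiples of each other.
  let π : (V →ₗ[F] F) → Quotient (MulAction.orbitRel Fˣ (V →ₗ[F] F)) := Quotient.mk _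
  have hπ : ∀ φ ψ : V →ₗ[F] F, π φ = π ψ ↔ ∃ u : Fˣ, u • ψ = φ := fun φ ψ => by
    rw [Quotient.eq, MulAction.orbitRel_apply, MulAction.mem_orbit_iff]
  have hzero := natCard_not_multiple_eq f g h 0
  have fib : ∀ c, Nat.card {i : ι // π (LinearMap.proj i ∘ₗ f) = c}
      = Nat.card {j : κ // π (LinearMap.proj j ∘ₗ g) = c} := by
    intro c
    obtain ⟨γ, rfl⟩ := Quotient.exists_rep c
    change Nat.card {i : ι // π _ = π γ} = Nat.card {j : κ // π _ = π γ}
    by_cases hγ : γ = 0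
    · have hz : ∀ φ : V →ₗ[F] F, π φ = π γ ↔ ∃ t : F, φ = t • (0 : V →ₗ[F] F) := fun φ => by
        rw [hπ, hγ]
        simp [eq_comm]
      simp only [hz]
      have h1 := natCard_add_natCard_not (fun i : ι =>
        ∃ t : F, LinearMap.proj i ∘ₗ f = t • (0 : V →ₗ[F] F))
      have h2 := natCard_add_natCard_not (fun j : κ =>
        ∃ t : F, LinearMap.proj j ∘ₗ g = t • (0 : V →ₗ[F] F))
      omega
    · -- The columns that are not multiples of `0` are those in the class of `γ` and those that are
      -- not multiples of `γ`.
      have hz : ∀ φ : V →ₗ[F] F, (¬ ∃ t : F, φ = t • (0 : V →ₗ[F] F))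
          ↔ (π φ = π γ ∨ ¬ ∃ t : F, φ = t • γ) := by
        intro φ
        rw [hπ]
        constructor
        · intro h0
          by_cases h1 : ∃ t : F, φ = t • γ
          · obtain ⟨t, rfl⟩ := h1
            have ht : t ≠ 0 := by
              rintro rfl
              exact h0 ⟨0, by simp⟩
            exact Or.inl ⟨Units.mk0 t ht, rfl⟩
          · exact Or.inr h1
        · rintro (⟨u, rfl⟩ | h1) ⟨t, ht⟩
          · rw [smul_zero] at ht
            exact hγ ((smul_eq_zero_iff_eq u).1 ht)
          · exact h1 ⟨0, by rw [ht]; simp⟩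
      have hd : ∀ φ : V →ₗ[F] F, π φ = π γ → ¬ ¬ ∃ t : F, φ = t • γ := by
        intro φ hφ h0
        obtain ⟨u, rfl⟩ := (hπ _ _).1 hφ
        exact h0 ⟨u, rfl⟩
      have h1 := natCard_subtype_eq_add (fun i => hz (LinearMap.proj i ∘ₗ f)) fun i => hd _
      have h2 := natCard_subtype_eq_add (fun j => hz (LinearMap.proj j ∘ₗ g)) fun j => hd _
      have h3 := natCard_not_multiple_eq f g h γ
      omega
  obtain ⟨e, he⟩ := exists_equiv_of_natCard_fiber_eq _ _ fib
  choose u hu using fun i => (hπ _ _).1 (he i)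
  exact ⟨e, u, fun v i => (LinearMap.congr_fun (hu i) v).symm⟩

end Extension

/-! ### Weights in the building blocks -/

section Blocks

variable {F : Type u} [Field F]

lemma wt_comp_fst {ι : Type*} (m : ℕ) (c : ι → F) :
    wt (fun p : ι × Fin m => c p.1) = m * wt c := by
  have e : {p : ι × Fin m // c p.1 ≠ 0} ≃ {i // c i ≠ 0} × Fin m :=
    { toFun := fun p => (⟨p.1.1, p.2⟩, p.1.2)
      invFun := fun p => ⟨(p.1.1, p.2), p.1.2⟩
      left_inv := fun _ => rfl
      right_inv := fun _ => rfl }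
  rw [wt_eq_natCard, wt_eq_natCard, Nat.card_congr e, Nat.card_prod, Nat.card_fin, mul_comm]

lemma mem_repetition {ι : Type*} {m : ℕ} {C : Submodule F (ι → F)} {d : ι × Fin m → F} :
    d ∈ repetition m C ↔ ∃ c ∈ C, (fun p => c p.1) = d := Iff.rfl

/-- Repeating every position at least once is injective on words. -/
noncomputable def repetitionEquiv {ι : Type*} {m : ℕ} (hm : 0 < m) (C : Submodule F (ι → F)) :
    C ≃ₗ[F] repetition m C :=
  Submodule.equivMapOfInjective _
    (LinearMap.funLeft_injective_of_surjective F F _ fun i => ⟨(i, ⟨0, hm⟩), rfl⟩) C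

lemma coe_repetitionEquiv {ι : Type*} {m : ℕ} (hm : 0 < m) (C : Submodule F (ι → F)) (c : C) :
    ((repetitionEquiv hm C c : repetition m C) : ι × Fin m → F) = fun p => (c : ι → F) p.1 := rfl

lemma wt_repetitionEquiv {ι : Type*} {m : ℕ} (hm : 0 < m) (C : Submodule F (ι → F)) (c : C) :
    wt (repetitionEquiv hm C c : ι × Fin m → F) = m * wt (c : ι → F) := by
  rw [coe_repetitionEquiv, wt_comp_fst]

variable [Fintype F]

lemma eq_one_of_card_eq_two (hq : Fintype.card F = 2) {t : F} (ht : t ≠ 0) : t = 1 := by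
  have h := FiniteField.pow_card_sub_one_eq_one t ht
  simpa [hq] using h

instance Block.finite_pos (b : Block) : Finite (b.Pos F) := by
  cases b with
  | simplex k => exact inferInstanceAs (Finite (Projectivization F (Fin k → F)))
  | reedMuller k => exact inferInstanceAs (Finite (Fin (k - 1) → F))
  | parityCheck k => exact inferInstanceAs (Finite (ULift (Fin (k + 1))))

/-- The dual pairing with a fixed vector, as a linear functional. -/
def dotFunctional {κ : Type*} [Fintype κ] (x : κ → F) : (κ → F) →ₗ[F] F where
  toFun v := x ⬝ᵥ v
  map_add' := dotProduct_add x
  map_smul' := fun t v => by simp [dotProduct_smul]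

omit [Fintype F] in
lemma dotFunctional_ne_zero {κ : Type*} [Fintype κ] {x : κ → F} (hx : x ≠ 0) :
    dotFunctional x ≠ 0 := fun h =>
  hx (dotProduct_eq_zero x fun v => LinearMap.congr_fun h v)

lemma natCard_dotProduct_eq {k : ℕ} {x : Fin (k + 1) → F} (hx : x ≠ 0) (t : F) :
    Nat.card {v // x ⬝ᵥ v = t} = Fintype.card F ^ k := by
  have h := natCard_fiber_mul_card (dotFunctional x) (dotFunctional_ne_zero hx) t
  rw [Nat.card_fun, Nat.card_fin, Nat.card_eq_fintype_card (α := F), pow_succ] at h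
  exact Nat.eq_of_mul_eq_mul_right Fintype.card_pos h

/-- The points off a hyperplane `x ⬝ᵥ v = 0` are represented by the vectors with `x ⬝ᵥ v = 1`. -/
lemma natCard_points_off_hyperplane {k : ℕ} {x : Fin (k + 1) → F} (hx : x ≠ 0) :
    Nat.card {p : Projectivization F (Fin (k + 1) → F) // x ⬝ᵥ p.rep ≠ 0}
      = Fintype.card F ^ k := by
  rw [← natCard_dotProduct_eq hx 1]
  have hne : ∀ v : {v // x ⬝ᵥ v = 1}, v.1 ≠ 0 := by
    rintro ⟨v, hv⟩ rfl
    simp at hv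
  symm
  refine Nat.card_congr (Equiv.ofBijective
    (fun v => ⟨Projectivization.mk F v.1 (hne v), ?_⟩) ⟨?_, ?_⟩)
  · obtain ⟨u, hu⟩ := Projectivization.exists_smul_eq_mk_rep F v.1 (hne v)
    rw [← hu, Units.smul_def, dotProduct_smul, v.2]
    simp
  · intro v w hvw
    have h := (Projectivization.mk_eq_mk_iff F v.1 w.1 (hne v) (hne w)).1 (Subtype.ext_iff.1 hvw)
    obtain ⟨u, hu⟩ := h
    have h1 : x ⬝ᵥ v.1 = u * x ⬝ᵥ w.1 := by rw [← hu, Units.smul_def, dotProduct_smul, smul_eq_mul]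
    rw [v.2, w.2, mul_one] at h1
    refine Subtype.ext ?_
    rw [← hu, Units.smul_def, ← h1, one_smul]
  · rintro ⟨p, hp⟩
    refine ⟨⟨(x ⬝ᵥ p.rep)⁻¹ • p.rep, by simp [dotProduct_smul, hp]⟩, Subtype.ext ?_⟩
    refine Eq.trans ?_ p.mk_rep
    exact (Projectivization.mk_eq_mk_iff' F _ _ _ _).2 ⟨(x ⬝ᵥ p.rep)⁻¹, rfl⟩

omit [Fintype F] in
lemma natCard_range_of_injective {V ι : Type*} [AddCommGroup V] [Module F V]
    (f : V →ₗ[F] (ι → F)) (hf : Function.Injective f) :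
    Nat.card (LinearMap.range f) = Nat.card V :=
  (Nat.card_congr (LinearEquiv.ofInjective f hf).toEquiv).symm

omit [Fintype F] in
lemma injective_of_wt_pos {V ι : Type*} [AddCommGroup V] [Module F V]
    (f : V →ₗ[F] (ι → F)) (hf : ∀ v, v ≠ 0 → 0 < wt (f v)) : Function.Injective f := by
  refine (injective_iff_map_eq_zero f).2 fun v hv => ?_
  by_contra h
  have := hf v h
  simp [hv] at this

omit [Fintype F] in
lemma rowSpace_eq_range {κ ι : Type*} [Fintype κ] (G : Matrix κ ι F) :
    rowSpace G = LinearMap.range G.vecMulLinear := (range_vecMulLinear G).symm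

lemma simplexCode_spec (k : ℕ) :
    Nat.card (simplexCode F (k + 1)) = Fintype.card F ^ (k + 1) ∧
      ∀ c ∈ simplexCode F (k + 1), c ≠ 0 → wt c = Fintype.card F ^ k := by
  rw [simplexCode, rowSpace_eq_range]
  set G : Matrix (Fin (k + 1)) (Projectivization F (Fin (k + 1) → F)) F :=
    Matrix.of fun i p => p.rep i
  have hw : ∀ x, x ≠ 0 → wt (G.vecMulLinear x) = Fintype.card F ^ k := fun x hx =>
    natCard_points_off_hyperplane hx
  constructor
  · rw [natCard_range_of_injective _ (injective_of_wt_pos _ fun x hx => ?_)]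
    · simp [Nat.card_eq_fintype_card]
    · rw [hw x hx]
      exact pow_pos Fintype.card_pos _
  · rintro _ ⟨x, rfl⟩ hx
    refine hw x ?_
    rintro rfl
    simp at hx

omit [Fintype F] in
lemma simplexCode_full (k : ℕ) (p : Projectivization F (Fin k → F)) :
    ∃ c ∈ simplexCode F k, c p ≠ 0 := by
  obtain ⟨i, hi⟩ := Function.ne_iff.1 p.rep_nonzero
  exact ⟨_, Submodule.subset_span ⟨i, rfl⟩, hi⟩

omit [Fintype F] in
lemma reedMullerCode_full (k : ℕ) (v : Fin (k - 1) → F) :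
    ∃ c ∈ reedMullerCode F k, c v ≠ 0 :=
  ⟨_, Submodule.subset_span ⟨Sum.inr (), rfl⟩, one_ne_zero⟩

/-- Over the field with two elements, the word `1` of the first order Reed-Muller code has full
weight and all other nonzero words have half of that weight. -/
lemma reedMullerCode_spec (hq : Fintype.card F = 2) (k : ℕ) :
    Nat.card (reedMullerCode F (k + 2)) = 2 ^ (k + 2) ∧
      ∃ o ∈ reedMullerCode F (k + 2), wt o = 2 ^ (k + 1) ∧
        ∀ c ∈ reedMullerCode F (k + 2), c ≠ 0 → c ≠ o → wt c = 2 ^ k := by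
  have h01 : ∀ t : F, t ≠ 0 → t = 1 := fun t => eq_one_of_card_eq_two hq
  rw [reedMullerCode, rowSpace_eq_range]
  set G : Matrix (Fin (k + 1) ⊕ Unit) (Fin (k + 1) → F) F := Matrix.fromRows
    (Matrix.of fun (i : Fin (k + 1)) (v : Fin (k + 1) → F) => v i)
    (Matrix.of fun (_ : Unit) (_ : Fin (k + 1) → F) => (1 : F))
  have hG : ∀ x v, G.vecMulLinear x v = (x ∘ Sum.inl) ⬝ᵥ v + x (Sum.inr ()) := by
    intro x v
    change x ⬝ᵥ (fun i => G i v) = _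
    simp [G, dotProduct]
  have hwl : ∀ x, x ∘ Sum.inl ≠ 0 → wt (G.vecMulLinear x) = 2 ^ k := by
    intro x hx
    rw [wt_eq_natCard, ← hq, ← natCard_dotProduct_eq hx (1 - x (Sum.inr ()))]
    refine Nat.card_congr (Equiv.subtypeEquivRight fun v => ?_)
    rw [hG, eq_sub_iff_add_eq]
    refine ⟨h01 _, fun h => ?_⟩
    rw [h]
    exact one_ne_zero
  have hwr : ∀ x, x ∘ Sum.inl = 0 → x ≠ 0 →
      G.vecMulLinear x = 1 := by
    intro x hx h0
    ext v
    rw [hG, hx, zero_dotProduct, zero_add, Pi.one_apply]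
    refine h01 _ fun h1 => h0 ?_
    ext j
    rcases j with i | j
    · exact congrFun hx i
    · exact h1
  have hw1 : wt (1 : (Fin (k + 1) → F) → F) = 2 ^ (k + 1) := by
    rw [wt_eq_natCard, ← hq]
    simp [Nat.card_eq_fintype_card]
  refine ⟨?_, 1, ⟨Pi.single (Sum.inr ()) 1, ?_⟩, hw1, ?_⟩
  · rw [natCard_range_of_injective _ (injective_of_wt_pos _ fun x hx => ?_)]
    · simp [Nat.card_eq_fintype_card, hq]
    · by_cases h : x ∘ Sum.inl = 0
      · refine lt_of_lt_of_eq ?_ (hw1.symm.trans (congrArg wt (hwr x h hx).symm))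
        positivity
      · refine lt_of_lt_of_eq ?_ (hwl x h).symm
        positivity
  · refine hwr _ (by ext i; simp) (by simp)
  · rintro _ ⟨x, rfl⟩ hx h1
    by_cases h : x ∘ Sum.inl = 0
    · refine absurd (hwr x h ?_) h1
      rintro rfl
      simp at hx
    · exact hwl x h

omit [Fintype F] in
lemma mem_parityCheckCode {k : ℕ} {c : ULift.{u} (Fin (k + 1)) → F} :
    c ∈ parityCheckCode F k ↔ ∑ i, c i = 0 := Iff.rfl

lemma natCard_parityCheckCode (k : ℕ) :
    Nat.card (parityCheckCode F k) = Fintype.card F ^ k := by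
  have h1 : (1 : ULift.{u} (Fin (k + 1)) → F) ≠ 0 := one_ne_zero
  have h := natCard_fiber_mul_card _ (dotFunctional_ne_zero h1) 0
  rw [Nat.card_fun, Nat.card_eq_fintype_card (α := F), Nat.card_ulift, Nat.card_fin, pow_succ] at h
  rw [← Nat.eq_of_mul_eq_mul_right Fintype.card_pos h]
  refine Nat.card_congr (Equiv.subtypeEquivRight fun c => ?_)
  simp [dotFunctional, mem_parityCheckCode, dotProduct]

/-- A word of weight two of the parity check code. -/
def pairWord {k : ℕ} (i j : ULift.{u} (Fin (k + 1))) : ULift.{u} (Fin (k + 1)) → F :=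
  Pi.single i 1 - Pi.single j 1

omit [Fintype F] in
lemma pairWord_mem {k : ℕ} (i j : ULift.{u} (Fin (k + 1))) :
    (pairWord i j : _ → F) ∈ parityCheckCode F k := by
  rw [mem_parityCheckCode]
  simp [pairWord, Finset.sum_sub_distrib]

omit [Fintype F] in
lemma parityCheckCode_full {k : ℕ} (hk : 1 ≤ k) (i : ULift.{u} (Fin (k + 1))) :
    ∃ c ∈ parityCheckCode F k, c i ≠ 0 := by
  have : Nontrivial (ULift.{u} (Fin (k + 1))) := by
    have : Nontrivial (Fin (k + 1)) := Fin.nontrivial_iff_two_le.2 (by omega)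
    infer_instance
  obtain ⟨j, hj⟩ := exists_ne i
  exact ⟨pairWord i j, pairWord_mem i j, by simp [pairWord, hj.symm]⟩

lemma Block.repetitions_pos {Δ a : ℕ} (hΔ : 0 < Δ) (ha : Fintype.card F ^ a ∣ Δ) {b : Block}
    (hb : b.IsAdmissible (Fintype.card F) a) : 0 < b.repetitions (Fintype.card F) Δ := by
  cases b with
  | simplex k =>
    have h : Fintype.card F ^ (k - 1) ∣ Δ := (pow_dvd_pow _ (by have := hb.2; omega)).trans ha
    exact Nat.div_pos (Nat.le_of_dvd hΔ h) (pow_pos Fintype.card_pos _)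
  | reedMuller k =>
    obtain ⟨hq, h3, hk⟩ := hb
    rw [hq] at ha
    have h : 2 ^ (k - 2) ∣ Δ := (pow_dvd_pow _ (by omega)).trans ha
    exact Nat.div_pos (Nat.le_of_dvd hΔ h) (by positivity)
  | parityCheck k =>
    obtain ⟨hq, h1, hk⟩ := hb
    rw [hq] at ha
    have h : 2 ^ 1 ∣ Δ := (pow_dvd_pow _ h1).trans ha
    exact Nat.div_pos (Nat.le_of_dvd hΔ (by simpa using h)) (by positivity)

/-- A block has no zero positions. -/
lemma Block.code_full {Δ a : ℕ} {b : Block} (hb : b.IsAdmissible (Fintype.card F) a)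
    (p : b.Pos F × Fin (b.repetitions (Fintype.card F) Δ)) : ∃ c ∈ b.code F Δ, c p ≠ 0 := by
  have h : ∃ c ∈ b.baseCode F, c p.1 ≠ 0 := by
    obtain ⟨p, -⟩ := p
    cases b with
    | simplex k => exact simplexCode_full k p
    | reedMuller k => exact reedMullerCode_full k p
    | parityCheck k => exact parityCheckCode_full (by have := hb.2.2; omega) p
  obtain ⟨c, hc, hcp⟩ := h
  exact ⟨_, mem_repetition.2 ⟨c, hc, rfl⟩, hcp⟩

lemma Block.simplex_code_spec {Δ a k : ℕ} (hΔ : 0 < Δ) (ha : Fintype.card F ^ a ∣ Δ)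
    (hb : (Block.simplex k).IsAdmissible (Fintype.card F) a) :
    Nat.card ((Block.simplex k).code F Δ) = Fintype.card F ^ k ∧
      ∀ c ∈ (Block.simplex k).code F Δ, c ≠ 0 → wt c = Δ := by
  have hpos := Block.repetitions_pos hΔ ha hb
  obtain ⟨h1, h2⟩ := hb
  obtain ⟨k, rfl⟩ := Nat.exists_eq_add_of_le' h1
  obtain ⟨hc, hw⟩ := simplexCode_spec (F := F) k
  refine ⟨(Nat.card_congr (repetitionEquiv hpos _).symm.toEquiv).trans hc, ?_⟩
  rintro _ ⟨c, hc', rfl⟩ h0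
  have hd : Fintype.card F ^ k ∣ Δ := (pow_dvd_pow _ (by omega)).trans ha
  refine (wt_comp_fst _ c).trans ?_
  rw [show wt c = Fintype.card F ^ k from hw c hc' (by rintro rfl; exact h0 (map_zero _))]
  exact Nat.div_mul_cancel hd

lemma Block.reedMuller_code_spec {Δ a k : ℕ} (hΔ : 0 < Δ) (ha : Fintype.card F ^ a ∣ Δ)
    (hb : (Block.reedMuller k).IsAdmissible (Fintype.card F) a) :
    Nat.card ((Block.reedMuller k).code F Δ) = 2 ^ k ∧
      ∃ o ∈ (Block.reedMuller k).code F Δ, wt o = 2 * Δ ∧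
        ∀ c ∈ (Block.reedMuller k).code F Δ, c ≠ 0 → c ≠ o → wt c = Δ := by
  have hpos := Block.repetitions_pos hΔ ha hb
  obtain ⟨hq, h3, hk⟩ := hb
  obtain ⟨k, rfl⟩ := Nat.exists_eq_add_of_le' (show 2 ≤ k by omega)
  obtain ⟨hc, o, ho, hwo, hw⟩ := reedMullerCode_spec hq k
  have hd : 2 ^ k ∣ Δ := (pow_dvd_pow _ (by omega)).trans (hq ▸ ha)
  refine ⟨(Nat.card_congr (repetitionEquiv hpos _).symm.toEquiv).trans hc, _,
    mem_repetition.2 ⟨o, ho, rfl⟩, ?_, ?_⟩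
  · refine (wt_comp_fst _ o).trans ?_
    rw [hwo, pow_succ, ← mul_assoc, mul_comm _ 2]
    exact congrArg _ (Nat.div_mul_cancel hd)
  · rintro _ ⟨c, hc', rfl⟩ h0 h1
    refine (wt_comp_fst _ c).trans ?_
    rw [show wt c = 2 ^ k from hw c hc' (by rintro rfl; exact h0 (map_zero _))
      (by rintro rfl; exact h1 rfl)]
    exact Nat.div_mul_cancel hd

end Blocks

/-! ### Pairs of words of minimum weight -/

section Pairs

variable {F ι : Type*} [Field F]

/-- The codewords of weight `Δ`. -/
def minWords (Δ : ℕ) (V : Submodule F (ι → F)) : Set (ι → F) := {x | x ∈ V ∧ wt x = Δ}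

variable [Finite ι]

lemma wt_sub_smul_add (x y : ι → F) {t : F} (ht : t ≠ 0) :
    wt (x - t • y) + Nat.card {i // x i ≠ 0 ∧ x i = t * y i} + wt (x * y) = wt x + wt y := by
  have h1 : Function.support x ∪ Function.support y
      = Function.support (x - t • y) ∪ {i | x i ≠ 0 ∧ x i = t * y i} := by
    ext i
    simp only [Set.mem_union, Function.mem_support, Pi.sub_apply, Pi.smul_apply, smul_eq_mul,
      Set.mem_ofPred_eq, sub_ne_zero]
    by_cases h : x i = t * y i
    · by_cases hy : y i = 0 <;> simp [h, hy, ht]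
    · by_cases hx : x i = 0
      · simp only [hx, ne_eq, not_true_eq_false, false_or, false_and, or_false]
        rw [hx] at h
        exact ⟨fun _ => h, fun _ h0 => h (by simp [h0])⟩
      · simp [h, hx]
  have h2 : Function.support x ∩ Function.support y = Function.support (x * y) := by
    ext i
    simp
  have hd : Disjoint (Function.support (x - t • y)) {i | x i ≠ 0 ∧ x i = t * y i} := by
    rw [Set.disjoint_left]
    intro i hi hi'
    exact hi (by simpa [sub_eq_zero] using hi'.2)
  have h3 := Set.ncard_union_add_ncard_inter (Function.support x) (Function.support y)
    (Set.toFinite _) (Set.toFinite _)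
  rw [h1, h2, Set.ncard_union_eq hd (Set.toFinite _) (Set.toFinite _)] at h3
  exact h3

lemma sum_natCard_proportional [Fintype F] [Fintype Fˣ] (x y : ι → F) :
    ∑ t : Fˣ, Nat.card {i // x i ≠ 0 ∧ x i = t * y i} = wt (x * y) := by
  rw [← Nat.card_sigma, wt_eq_natCard]
  refine Nat.card_congr (Equiv.ofBijective (fun p => ⟨p.2.1, ?_⟩) ⟨?_, ?_⟩)
  · obtain ⟨t, i, hi, h⟩ := p
    rw [Pi.mul_apply]
    refine mul_ne_zero hi ?_
    rintro h0
    exact hi (by rw [h, h0, mul_zero])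
  · rintro ⟨t, i, hi, h⟩ ⟨t', i', hi', h'⟩ heq
    obtain rfl : i = i' := congrArg Subtype.val heq
    have hy : y i ≠ 0 := by
      rintro h0
      exact hi (by rw [h, h0, mul_zero])
    obtain rfl : t = t' := Units.ext (mul_right_cancel₀ hy (h.symm.trans h'))
    rfl
  · rintro ⟨i, hi⟩
    have hx : x i ≠ 0 := left_ne_zero_of_mul hi
    have hy : y i ≠ 0 := right_ne_zero_of_mul hi
    exact ⟨⟨Units.mk0 (x i / y i) (div_ne_zero hx hy), i, hx, by simp [hy]⟩, rfl⟩

/-- Two linearly independent words of weight `Δ` whose supports meet span a repeated simplex code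
of dimension two. For each `t ≠ 0` the number `N` of positions with `x = t * y` satisfies
`N + wt (x * y) = Δ`: this is the only positive multiple of `Δ` that leaves a positive weight for
`x - t • y`. Summing over `t` yields the size of the common support. -/
lemma wt_of_overlapping [Fintype F] {Δ : ℕ} {V : Submodule F (ι → F)}
    (hdiv : ∀ c ∈ V, Δ ∣ wt c) {x y : ι → F} (hx : x ∈ minWords Δ V) (hy : y ∈ minWords Δ V)
    (hxy : x * y ≠ 0) (hind : ∀ t : F, x ≠ t • y) :
    (∀ t : F, wt (x - t • y) = Δ) ∧ Fintype.card F * wt (x * y) = (Fintype.card F - 1) * Δ := by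
  have hm : 0 < wt (x * y) := wt_pos.2 hxy
  have key : ∀ t : F, t ≠ 0 → wt (x - t • y) = Δ ∧
      Nat.card {i // x i ≠ 0 ∧ x i = t * y i} + wt (x * y) = Δ := by
    intro t ht
    have h1 := wt_sub_smul_add x y ht
    rw [hx.2, hy.2] at h1
    have h2 : 0 < wt (x - t • y) := wt_pos.2 (sub_ne_zero.2 (hind t))
    obtain ⟨r, hr⟩ := hdiv _ (V.sub_mem hx.1 (V.smul_mem t hy.1))
    have hr1 : r = 1 := by
      rw [hr] at h1 h2
      have h3 : Δ * r < Δ * 2 := by omega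
      have h4 := lt_of_mul_lt_mul_left' h3
      have h5 := Nat.pos_of_mul_pos_left h2
      omega
    rw [hr1, mul_one] at hr
    omega
  refine ⟨fun t => ?_, ?_⟩
  · by_cases ht : t = 0
    · simp [ht, hx.2]
    · exact (key t ht).1
  · classical
    have h1 : ∑ t : Fˣ, (Nat.card {i // x i ≠ 0 ∧ x i = t * y i} + wt (x * y))
        = ∑ t : Fˣ, Δ := Finset.sum_congr rfl fun t _ => (key t t.ne_zero).2
    rw [Finset.sum_add_distrib, sum_natCard_proportional, Finset.sum_const, Finset.sum_const,
      Finset.card_univ, Fintype.card_units, smul_eq_mul, smul_eq_mul] at h1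
    have h3 : 1 ≤ Fintype.card F := Fintype.card_pos
    obtain ⟨r, hr⟩ := Nat.exists_eq_add_of_le' h3
    rw [hr] at h1 ⊢
    rw [Nat.add_sub_cancel] at h1 ⊢
    linarith

/-- Over a field with more than two elements, overlapping is transitive on words of weight `Δ`:
otherwise the support of the middle word contains two disjoint parts of relative size
`(q - 1) / q`. -/
lemma mul_ne_zero_of_overlapping [Fintype F] (hq : 2 < Fintype.card F) {Δ : ℕ} (hΔ : 0 < Δ)
    {V : Submodule F (ι → F)} (hdiv : ∀ c ∈ V, Δ ∣ wt c) {x y z : ι → F} (hx : x ∈ minWords Δ V)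
    (hy : y ∈ minWords Δ V) (hz : z ∈ minWords Δ V) (hxy : x * y ≠ 0) (hyz : y * z ≠ 0) :
    x * z ≠ 0 := by
  intro hxz
  have hdep : ∀ a b c : ι → F, a * b ≠ 0 → b * c ≠ 0 → a * c = 0 → ∀ t : F, a ≠ t • b := by
    rintro _ b c h1 h2 h3 t rfl
    by_cases ht : t = 0
    · simp [ht] at h1
    · rw [smul_mul_assoc, smul_eq_zero] at h3
      exact h3.elim ht h2
  have h1 := (wt_of_overlapping hdiv hx hy hxy (hdep x y z hxy hyz hxz)).2
  have h2 := (wt_of_overlapping hdiv hz hy (by rwa [mul_comm])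
    (hdep z y x (by rwa [mul_comm]) (by rwa [mul_comm]) (by rwa [mul_comm]))).2
  have h3 : wt (y * x + y * z) ≤ wt y := by
    rw [← mul_add]
    exact wt_mul_le _ _
  rw [wt_add_of_mul_eq_zero (by rw [mul_mul_mul_comm, hxz, mul_zero]), hy.2, mul_comm y x,
    mul_comm y z] at h3
  obtain ⟨r, hr⟩ := Nat.exists_eq_add_of_lt hq
  rw [hr] at h1 h2
  rw [show 2 + r + 1 - 1 = 2 + r from rfl] at h1 h2
  nlinarith

end Pairs

/-! ### Connected codes -/

section Connected

variable {F ι : Type*} [Field F] [Fintype F] [Finite ι]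

/-- A code is connected if the graph on its words of weight `Δ`, with two words adjacent when
their supports meet, is connected: a nonempty set of words closed under adjacency is everything. -/
def IsConnectedCode (Δ : ℕ) (V : Submodule F (ι → F)) : Prop :=
  ∀ S ⊆ minWords Δ V, S.Nonempty → (∀ x ∈ S, ∀ y ∈ minWords Δ V, x * y ≠ 0 → y ∈ S) →
    minWords Δ V ⊆ S

/-- If any two words of weight `Δ` overlap, all nonzero words have weight `Δ`. -/
lemma wt_eq_of_pairwise_overlapping {Δ : ℕ} {V : Submodule F (ι → F)}
    (hdiv : ∀ c ∈ V, Δ ∣ wt c) (hspan : Submodule.span F (minWords Δ V) = V)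
    (h : ∀ x ∈ minWords Δ V, ∀ y ∈ minWords Δ V, x * y ≠ 0) :
    ∀ v ∈ V, v ≠ 0 → wt v = Δ := by
  have key : ∀ v ∈ Submodule.span F (minWords Δ V), v ∈ V ∧ (v ≠ 0 → wt v = Δ) := by
    intro v hv
    induction hv using Submodule.span_induction with
    | mem x hx => exact ⟨hx.1, fun _ => hx.2⟩
    | zero => exact ⟨V.zero_mem, fun h => absurd rfl h⟩
    | smul t x _ hx =>
      refine ⟨V.smul_mem t hx.1, fun h0 => ?_⟩
      obtain ⟨ht, hx0⟩ := smul_ne_zero_iff.1 h0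
      rw [wt_smul ht, hx.2 hx0]
    | add x y _ _ hx hy =>
      refine ⟨V.add_mem hx.1 hy.1, fun h0 => ?_⟩
      by_cases hx0 : x = 0
      · rw [hx0, zero_add] at h0 ⊢
        exact hy.2 h0
      by_cases hy0 : y = 0
      · rw [hy0, add_zero] at h0 ⊢
        exact hx.2 h0
      have hxm : x ∈ minWords Δ V := ⟨hx.1, hx.2 hx0⟩
      have hym : y ∈ minWords Δ V := ⟨hy.1, hy.2 hy0⟩
      by_cases hd : ∃ t : F, x = t • y
      · obtain ⟨t, rfl⟩ := hd
        have h1 : t • y + y = (t + 1) • y := by rw [add_smul, one_smul]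
        rw [h1] at h0 ⊢
        rw [wt_smul (smul_ne_zero_iff.1 h0).1, hym.2]
      · push Not at hd
        simpa using (wt_of_overlapping hdiv hxm hym (h x hxm y hym) hd).1 (-1)
  exact fun v hv => (key v (by rwa [hspan])).2

end Connected

/-! ### Recognizing the building blocks -/

section Recognition

variable {F : Type u} {ι : Type*} [Field F] [Fintype F] [Finite ι]

/-- `V` is the image of the block code `b` under a weight-preserving linear map. -/
def IsBlockCopy (Δ : ℕ) (V : Submodule F (ι → F)) (b : Block) : Prop :=
  ∃ φ : b.code F Δ →ₗ[F] (ι → F),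
    (∀ d, wt (φ d) = wt (d : b.Pos F × Fin (b.repetitions (Fintype.card F) Δ) → F)) ∧
      LinearMap.range φ = V

lemma nonempty_linearEquiv_of_natCard_eq {V W : Type*} [AddCommGroup V] [Module F V] [Finite V]
    [AddCommGroup W] [Module F W] [Finite W] (h : Nat.card V = Nat.card W) :
    Nonempty (V ≃ₗ[F] W) := by
  rw [Module.natCard_eq_pow_finrank (K := F), Module.natCard_eq_pow_finrank (K := F) (V := W)] at h
  exact ⟨LinearEquiv.ofFinrankEq V W (Nat.pow_right_injective
    (by rw [Nat.card_eq_fintype_card]; exact Fintype.one_lt_card) h)⟩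

lemma exists_linearEquiv_apply_eq {V W : Type*} [AddCommGroup V] [Module F V] [Finite V]
    [AddCommGroup W] [Module F W] [Finite W] (h : Nat.card V = Nat.card W) {v : V} {w : W}
    (hv : v ≠ 0) (hw : w ≠ 0) : ∃ e : V ≃ₗ[F] W, e v = w := by
  obtain ⟨e⟩ := nonempty_linearEquiv_of_natCard_eq (F := F) h
  have hev : e v ≠ 0 := by simpa using hv
  obtain ⟨g, hg⟩ := Submodule.exists_linearEquiv_restrict_eq
    ((LinearEquiv.toSpanNonzeroSingleton F W (e v) hev).symm.trans
      (LinearEquiv.toSpanNonzeroSingleton F W w hw))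
  refine ⟨e.trans g, ?_⟩
  have h1 := hg ⟨e v, Submodule.mem_span_singleton_self _⟩
  have h2 : (LinearEquiv.toSpanNonzeroSingleton F W (e v) hev).symm
      ⟨e v, Submodule.mem_span_singleton_self _⟩ = 1 :=
    (LinearEquiv.symm_apply_eq _).2 (Subtype.ext (by simp))
  rw [LinearEquiv.trans_apply, ← h1, LinearEquiv.trans_apply, h2]
  simp

lemma isBlockCopy_simplex {Δ a k : ℕ} (hΔ : 0 < Δ) (ha : Fintype.card F ^ a ∣ Δ)
    (hb : (Block.simplex k).IsAdmissible (Fintype.card F) a) {V : Submodule F (ι → F)}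
    (hc : Nat.card V = Fintype.card F ^ k) (hw : ∀ v ∈ V, v ≠ 0 → wt v = Δ) :
    IsBlockCopy Δ V (Block.simplex k) := by
  obtain ⟨hc', hw'⟩ := Block.simplex_code_spec hΔ ha hb
  obtain ⟨e⟩ := nonempty_linearEquiv_of_natCard_eq (F := F) (hc'.trans hc.symm)
  refine ⟨V.subtype ∘ₗ e.toLinearMap, fun d => ?_, by simp [LinearMap.range_comp]⟩
  by_cases hd : d = 0
  · simp [hd]
  · rw [hw' _ d.2 (by simpa using hd)]
    exact hw _ (e d).2 (by simpa using hd)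

lemma isBlockCopy_reedMuller {Δ a k : ℕ} (hΔ : 0 < Δ) (ha : Fintype.card F ^ a ∣ Δ)
    (hb : (Block.reedMuller k).IsAdmissible (Fintype.card F) a) {V : Submodule F (ι → F)}
    (hc : Nat.card V = 2 ^ k) {o : ι → F} (ho : o ∈ V) (hwo : wt o = 2 * Δ)
    (hw : ∀ v ∈ V, v ≠ 0 → v ≠ o → wt v = Δ) :
    IsBlockCopy Δ V (Block.reedMuller k) := by
  obtain ⟨hc', o', ho', hwo', hw'⟩ := Block.reedMuller_code_spec hΔ ha hb
  obtain ⟨e, he⟩ := exists_linearEquiv_apply_eq (F := F) (hc'.trans hc.symm)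
    (v := ⟨o', ho'⟩) (w := ⟨o, ho⟩)
    (fun h => by
      rw [show o' = 0 from congrArg Subtype.val h, wt_zero] at hwo'
      omega)
    (fun h => by
      rw [show o = 0 from congrArg Subtype.val h, wt_zero] at hwo
      omega)
  refine ⟨V.subtype ∘ₗ e.toLinearMap, fun d => ?_, by simp [LinearMap.range_comp]⟩
  by_cases hd : d = 0
  · simp [hd]
  by_cases hd' : d = ⟨o', ho'⟩
  · rw [hd']
    exact (congrArg (fun v : V => wt (v : ι → F)) he).trans (hwo.trans hwo'.symm)
  · rw [hw' _ d.2 (by simpa using hd) (fun h => hd' (Subtype.ext h))]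
    refine hw _ (e d).2 (by simpa using hd) fun h => hd' (e.injective ?_)
    rw [he]
    exact Subtype.ext h

end Recognition

/-! ### Binary codes -/

section Binary

variable {F : Type u} {ι : Type*} [Field F] [Fintype F]

lemma add_self_of_card_eq_two (hq : Fintype.card F = 2) (x : ι → F) : x + x = 0 := by
  have h : (1 : F) + 1 = 0 := by
    by_contra h
    exact one_ne_zero (add_eq_left.1 (eq_one_of_card_eq_two hq h))
  ext i
  rw [Pi.add_apply, Pi.zero_apply, ← one_mul (x i), ← add_mul, h, zero_mul]

lemma mul_eq_left_of_card_eq_two (hq : Fintype.card F = 2) {x y : ι → F}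
    (h : ∀ i, x i ≠ 0 → y i ≠ 0) : x * y = x := by
  ext i
  by_cases hx : x i = 0
  · simp [hx]
  · rw [Pi.mul_apply, eq_one_of_card_eq_two hq (h i hx), mul_one]

lemma mul_self_of_card_eq_two (hq : Fintype.card F = 2) (x : ι → F) : x * x = x :=
  mul_eq_left_of_card_eq_two hq fun _ h => h

variable [Finite ι]

lemma wt_of_overlapping_binary (hq : Fintype.card F = 2) {Δ : ℕ} {V : Submodule F (ι → F)}
    (hdiv : ∀ c ∈ V, Δ ∣ wt c) {x y : ι → F} (hx : x ∈ minWords Δ V) (hy : y ∈ minWords Δ V)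
    (hxy : x * y ≠ 0) (hne : x ≠ y) : 2 * wt (x * y) = Δ := by
  have h := (wt_of_overlapping hdiv hx hy hxy fun t => ?_).2
  · simpa [hq] using h
  · by_cases ht : t = 0
    · rintro rfl
      simp [ht] at hxy
    · rwa [eq_one_of_card_eq_two hq ht, one_smul]

/-- A frame of a binary code `V`: pairwise disjoint words of weight `h`, not necessarily in `V`,
whose pairwise sums lie in `V`. The sums of evenly many members form a copy of a repeated parity
check code in `V`. -/
structure IsFrame (h : ℕ) (V : Submodule F (ι → F)) (A : Finset (ι → F)) : Prop where
  wt_eq : ∀ a ∈ A, wt a = h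
  mul_eq_zero : ∀ a ∈ A, ∀ b ∈ A, a ≠ b → a * b = 0
  add_mem : ∀ a ∈ A, ∀ b ∈ A, a + b ∈ V

open Classical in
/-- A word `u` of weight `2 * h` that contains one member `a` of a frame and is disjoint from the
others enlarges the frame by its other half `u + a`. -/
lemma IsFrame.insert_add (hq : Fintype.card F = 2) {h : ℕ} (hh : 0 < h) {V : Submodule F (ι → F)}
    {A : Finset (ι → F)} (hA : IsFrame h V A) {a u : ι → F} (ha : a ∈ A)
    (hu : u ∈ minWords (2 * h) V)
    (hau : a * u = a) (hub : ∀ b ∈ A, b ≠ a → u * b = 0) :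
    u + a ∉ A ∧ IsFrame h V (insert (u + a) A) := by
  have haa := add_self_of_card_eq_two hq a
  have h0 : (u + a) * a = 0 := by
    rw [add_mul, mul_self_of_card_eq_two hq, mul_comm, hau, haa]
  have h1 : ∀ b ∈ A, (u + a) * b = 0 := by
    intro b hb
    by_cases hba : b = a
    · rw [hba, h0]
    · rw [add_mul, hub b hb hba, hA.mul_eq_zero a ha b hb (Ne.symm hba), add_zero]
  have hw : wt (u + a) = h := by
    have h2 := wt_add_of_mul_eq_zero h0
    rw [add_assoc, haa, add_zero, hu.2, hA.wt_eq a ha] at h2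
    omega
  have h2 : ∀ b ∈ A, u + a + b ∈ V := fun b hb => by
    rw [add_assoc]
    exact V.add_mem hu.1 (hA.add_mem a ha b hb)
  refine ⟨fun hmem => ?_, ⟨?_, ?_, ?_⟩⟩
  · have h3 := h1 _ hmem
    rw [mul_self_of_card_eq_two hq] at h3
    rw [h3, wt_zero] at hw
    omega
  · intro b hb
    rcases Finset.mem_insert.1 hb with rfl | hb
    · exact hw
    · exact hA.wt_eq b hb
  · intro b hb c hc hbc
    rcases Finset.mem_insert.1 hb with rfl | hb' <;> rcases Finset.mem_insert.1 hc with rfl | hc'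
    · exact absurd rfl hbc
    · exact h1 c hc'
    · rw [mul_comm]
      exact h1 b hb'
    · exact hA.mul_eq_zero b hb' c hc' hbc
  · intro b hb c hc
    rcases Finset.mem_insert.1 hb with rfl | hb' <;> rcases Finset.mem_insert.1 hc with rfl | hc'
    · rw [add_self_of_card_eq_two hq]
      exact V.zero_mem
    · exact h2 c hc'
    · rw [add_comm]
      exact h2 b hb'
    · exact hA.add_mem b hb' c hc'

/-- A path `x`, `y`, `z` in the graph of overlapping words, with `x` and `z` disjoint, cuts the
positions into four parts, which form a frame. -/
lemma exists_frame_card_eq_four (hq : Fintype.card F = 2) {h : ℕ} (hh : 0 < h)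
    {V : Submodule F (ι → F)} (hdiv : ∀ c ∈ V, 2 * h ∣ wt c) {x y z : ι → F}
    (hx : x ∈ minWords (2 * h) V) (hy : y ∈ minWords (2 * h) V) (hz : z ∈ minWords (2 * h) V)
    (hxy : x * y ≠ 0) (hyz : y * z ≠ 0) (hxz : x * z = 0) :
    ∃ A : Finset (ι → F), IsFrame h V A ∧ A.card = 4 := by
  classical
  have hwxy : wt (x * y) = h := by
    have := wt_of_overlapping_binary hq hdiv hx hy hxy (by rintro rfl; exact hyz hxz)
    omega
  have hwyz : wt (y * z) = h := by
    have := wt_of_overlapping_binary hq hdiv hy hz hyz (by rintro rfl; exact hxy hxz)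
    omega
  have hxx := mul_self_of_card_eq_two hq x
  have hyy := mul_self_of_card_eq_two hq y
  have h1 : IsFrame h V {x * y} := by
    refine ⟨by simpa using hwxy, ?_, ?_⟩
    · intro b hb c hc hbc
      rw [Finset.mem_singleton] at hb hc
      exact absurd (hb.trans hc.symm) hbc
    · intro b hb c hc
      rw [Finset.mem_singleton] at hb hc
      rw [hb, hc, add_self_of_card_eq_two hq]
      exact V.zero_mem
  obtain ⟨hn2, h2⟩ := h1.insert_add hq hh (Finset.mem_singleton_self _) hx
    (by rw [mul_right_comm, hxx]) (fun b hb hne => absurd (Finset.mem_singleton.1 hb) hne)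
  obtain ⟨hn3, h3⟩ := h2.insert_add hq hh (a := x * y) (by simp) hy (by rw [mul_assoc, hyy]) (by
    intro b hb hne
    have hb' : b = x + x * y := by simpa [hne] using hb
    rw [hb', mul_add, mul_left_comm, hyy, mul_comm y x, add_self_of_card_eq_two hq])
  have hw : wt (y + x * y) = h := h3.wt_eq _ (Finset.mem_insert_self _ _)
  have hmul : (y + x * y) * z = y * z := by
    rw [add_mul, mul_right_comm, hxz, zero_mul, add_zero]
  obtain ⟨hn4, h4⟩ := h3.insert_add hq hh (a := y + x * y) (Finset.mem_insert_self _ _) hz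
    (mul_eq_left_of_card_eq_two hq fun i => support_subset_of_wt_mul_eq (by rw [hw, hmul, hwyz]))
    (by
      intro b hb hne
      have hb' : b = x + x * y ∨ b = x * y := by simpa [hne] using hb
      have hzx : z * x = 0 := by rw [mul_comm, hxz]
      rcases hb' with rfl | rfl
      · rw [mul_add, ← mul_assoc, hzx, zero_mul, add_zero]
      · rw [← mul_assoc, hzx, zero_mul])
  refine ⟨_, h4, ?_⟩
  rw [Finset.card_insert_of_notMem hn4, Finset.card_insert_of_notMem hn3,
    Finset.card_insert_of_notMem hn2, Finset.card_singleton]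

open Classical in
/-- How a word `u` of weight `2 * h` meets a frame with at least four members that cannot be
enlarged. The sizes of the intersections of `u` with the members add up, in pairs, to `0` or `h`
unless `u` is itself a sum of two members. So they are all zero, or `h` once and zero otherwise
(and `u` enlarges the frame), or all equal to `h / 2`; the latter needs exactly four members, which
then cover `u`. -/
lemma IsFrame.cases_of_maximal (hq : Fintype.card F = 2) {h : ℕ} (hh : 0 < h)
    {V : Submodule F (ι → F)} (hdiv : ∀ c ∈ V, 2 * h ∣ wt c) {A : Finset (ι → F)}
    (hA : IsFrame h V A) (hcard : 4 ≤ A.card)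
    (hmax : ∀ w, w ∉ A → ¬ IsFrame h V (insert w A)) {u : ι → F} (hu : u ∈ minWords (2 * h) V) :
    (∀ a ∈ A, u * a = 0) ∨ (∃ a ∈ A, ∃ b ∈ A, a ≠ b ∧ u = a + b) ∨
      (A.card = 4 ∧ u * ∑ a ∈ A, a = u) := by
  by_cases hsum : ∃ a ∈ A, ∃ b ∈ A, a ≠ b ∧ u = a + b
  · exact Or.inr (Or.inl hsum)
  by_cases hdis : ∀ a ∈ A, u * a = 0
  · exact Or.inl hdis
  refine Or.inr (Or.inr ?_)
  have hs : ∀ a ∈ A, ∀ b ∈ A, a ≠ b →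
      wt (u * a) + wt (u * b) = 0 ∨ wt (u * a) + wt (u * b) = h := by
    intro a ha b hb hab
    have hab0 := hA.mul_eq_zero a ha b hb hab
    have h1 : wt (u * (a + b)) = wt (u * a) + wt (u * b) := by
      rw [mul_add, wt_add_of_mul_eq_zero]
      rw [mul_mul_mul_comm, hab0, mul_zero]
    have h2 : a + b ∈ minWords (2 * h) V := by
      refine ⟨hA.add_mem a ha b hb, ?_⟩
      rw [wt_add_of_mul_eq_zero hab0, hA.wt_eq a ha, hA.wt_eq b hb]
      ring
    rw [← h1]
    by_cases h3 : u * (a + b) = 0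
    · left
      rw [h3, wt_zero]
    · right
      have := wt_of_overlapping_binary hq hdiv hu h2 h3 fun h4 => hsum ⟨a, ha, b, hb, hab, h4⟩
      omega
  push Not at hdis
  obtain ⟨a, ha, hua⟩ := hdis
  have hpos : 0 < wt (u * a) := wt_pos.2 hua
  have hother : ∀ b ∈ A, b ≠ a → wt (u * a) + wt (u * b) = h := by
    intro b hb hba
    have := hs a ha b hb (Ne.symm hba)
    omega
  obtain ⟨b, hb, c, hc, hbc⟩ := Finset.one_lt_card.1
    (show 1 < (A.erase a).card by rw [Finset.card_erase_of_mem ha]; omega)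
  rw [Finset.mem_erase] at hb hc
  have h1 := hother b hb.2 hb.1
  have h2 := hother c hc.2 hc.1
  have hhalf : 2 * wt (u * a) = h := by
    rcases hs b hb.2 c hc.2 hbc with h3 | h3
    · exfalso
      have h4 : wt (u * a) = h := by omega
      obtain ⟨hn, hf⟩ := hA.insert_add hq hh ha hu
        (mul_eq_left_of_card_eq_two hq fun i => support_subset_of_wt_mul_eq (by
          rw [mul_comm a u, h4, hA.wt_eq a ha]))
        (fun d hd hda => by
          have := hother d hd hda
          exact wt_eq_zero.1 (by omega))
      exact hmax _ hn hf
    · omega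
  have hall : ∀ d ∈ A, wt (u * d) = wt (u * a) := by
    intro d hd
    by_cases hda : d = a
    · rw [hda]
    · have := hother d hd hda
      omega
  have hw : wt (u * ∑ d ∈ A, d) = A.card * wt (u * a) := by
    rw [Finset.mul_sum, wt_sum_of_mul_eq_zero, Finset.sum_congr rfl hall, Finset.sum_const,
      smul_eq_mul]
    intro d hd e he hde
    rw [mul_mul_mul_comm, hA.mul_eq_zero d hd e he hde, mul_zero]
  have hle := wt_mul_le u (∑ d ∈ A, d)
  rw [hw, hu.2, ← hhalf] at hle
  have hc4 : A.card = 4 := by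
    refine le_antisymm ?_ hcard
    by_contra h5
    have : 5 * wt (u * a) ≤ A.card * wt (u * a) := Nat.mul_le_mul_right _ (by omega)
    omega
  refine ⟨hc4, mul_eq_left_of_card_eq_two hq fun i => support_subset_of_wt_mul_eq ?_⟩
  rw [hw, hu.2, hc4]
  omega


/-- A binary code whose words of weight `2 * h` are the pairwise sums of a frame is a repeated
parity check code. -/
lemma IsFrame.isBlockCopy_parityCheck (hq : Fintype.card F = 2) {h : ℕ} (hh : 0 < h)
    {V : Submodule F (ι → F)} (hspan : Submodule.span F (minWords (2 * h) V) = V)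
    {A : Finset (ι → F)} (hA : IsFrame h V A) {k : ℕ} (hcard : A.card = k + 1)
    (hmin : ∀ u ∈ minWords (2 * h) V, ∃ a ∈ A, ∃ b ∈ A, a ≠ b ∧ u = a + b) :
    IsBlockCopy (2 * h) V (Block.parityCheck k) := by
  have hrep : (Block.parityCheck k).repetitions (Fintype.card F) (2 * h) = h :=
    Nat.mul_div_cancel_left h two_pos
  have hpos : 0 < (Block.parityCheck k).repetitions (Fintype.card F) (2 * h) := by rwa [hrep]
  let ε : ULift.{u} (Fin (k + 1)) ≃ A := Equiv.ulift.trans (A.equivFinOfCardEq hcard).symm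
  let L : (ULift.{u} (Fin (k + 1)) → F) →ₗ[F] (ι → F) :=
    Fintype.linearCombination F (fun i => (ε i : ι → F))
  have hL : ∀ c, L c = ∑ i, c i • (ε i : ι → F) := fun c => rfl
  have hwL : ∀ c, wt (L c) = h * wt c := by
    classical
    intro c
    rw [hL, wt_sum_of_mul_eq_zero]
    · have h1 : ∀ i, wt (c i • (ε i : ι → F)) = if c i ≠ 0 then h else 0 := by
        intro i
        split_ifs with hc
        · rw [wt_smul hc, hA.wt_eq _ (ε i).2]
        · simp [not_not.1 hc]
      rw [Finset.sum_congr rfl fun i _ => h1 i, ← Finset.sum_filter, Finset.sum_const, smul_eq_mul,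
        wt_eq_natCard, Nat.card_eq_fintype_card, Fintype.card_subtype, mul_comm]
    · intro i _ j _ hij
      rw [smul_mul_smul_comm, hA.mul_eq_zero _ (ε i).2 _ (ε j).2, smul_zero]
      exact fun h0 => hij (ε.injective (Subtype.ext h0))
  let ρ : (Block.parityCheck k).code F (2 * h) ≃ₗ[F] parityCheckCode F k :=
    (repetitionEquiv hpos _).symm
  refine ⟨L ∘ₗ (parityCheckCode F k).subtype ∘ₗ ρ.toLinearMap, fun d => ?_, ?_⟩
  · obtain ⟨c, rfl⟩ := ρ.symm.surjective d
    have h1 := (wt_repetitionEquiv hpos _ c).trans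
      (congrArg (· * wt (c : ULift.{u} (Fin (k + 1)) → F)) hrep)
    refine Eq.trans ?_ h1.symm
    simp [hwL]
  · rw [LinearMap.range_comp, LinearMap.range_comp_of_range_eq_top _ (LinearEquiv.range ρ),
      Submodule.range_subtype]
    apply le_antisymm
    · rintro _ ⟨c, hc, rfl⟩
      have h1 : L c = ∑ i, c i • ((ε i : ι → F) + ε ⟨0⟩) := by
        simp only [smul_add, Finset.sum_add_distrib, ← Finset.sum_smul]
        rw [mem_parityCheckCode.1 hc, zero_smul, add_zero, hL]
      rw [h1]
      exact V.sum_mem fun i _ => V.smul_mem _ (hA.add_mem _ (ε i).2 _ (ε _).2)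
    · rw [← hspan, Submodule.span_le]
      intro u hu
      obtain ⟨a, ha, b, hb, -, rfl⟩ := hmin u hu
      obtain ⟨i, hi⟩ := ε.surjective ⟨a, ha⟩
      obtain ⟨j, hj⟩ := ε.surjective ⟨b, hb⟩
      refine ⟨pairWord i j, pairWord_mem i j, ?_⟩
      have hb2 : a - b = a + b := by
        rw [sub_eq_iff_eq_add, add_assoc, add_self_of_card_eq_two hq, add_zero]
      rw [← hb2, pairWord, map_sub]
      simp [hL, Pi.single_apply, hi, hj]

/-- If a frame with four members covers all words of weight `2 * h`, the code is a repeated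
first order Reed-Muller code: the sum `o` of the frame has weight `4 * h`, and every other nonzero
word, being covered by `o`, has weight `2 * h`. -/
lemma IsFrame.exists_isBlockCopy_reedMuller (hq : Fintype.card F = 2) {h a : ℕ} (hh : 0 < h)
    (ha : IsGreatest {m : ℕ | Fintype.card F ^ m ∣ 2 * h} a)
    {V : Submodule F (ι → F)} (hdiv : ∀ c ∈ V, 2 * h ∣ wt c)
    (hspan : Submodule.span F (minWords (2 * h) V) = V)
    {A : Finset (ι → F)} (hA : IsFrame h V A) (hcard : A.card = 4)
    (hcov : ∀ u ∈ minWords (2 * h) V, u * ∑ b ∈ A, b = u) :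
    ∃ k, (Block.reedMuller k).IsAdmissible (Fintype.card F) a ∧
      IsBlockCopy (2 * h) V (Block.reedMuller k) := by
  classical
  set o := ∑ b ∈ A, b with ho
  obtain ⟨a₀, ha₀⟩ : A.Nonempty := Finset.card_pos.1 (by omega)
  have hoV : o ∈ V := by
    have h1 : o = ∑ b ∈ A, (b + a₀) := by
      rw [Finset.sum_add_distrib, Finset.sum_const, hcard, show 4 = 2 * 2 from rfl, mul_smul,
        two_smul ℕ a₀, add_self_of_card_eq_two hq, smul_zero, add_zero]
    rw [h1]
    exact V.sum_mem fun b hb => hA.add_mem b hb a₀ ha₀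
  have hwo : wt o = 2 * (2 * h) := by
    rw [ho, wt_sum_of_mul_eq_zero A (fun b => b) hA.mul_eq_zero,
      Finset.sum_congr rfl hA.wt_eq, Finset.sum_const, hcard, smul_eq_mul]
    ring
  have hcovV : ∀ v ∈ V, v * o = v := by
    intro v hv
    rw [← hspan] at hv
    induction hv using Submodule.span_induction with
    | mem x hx => exact hcov x hx
    | zero => rw [zero_mul]
    | smul t x _ hx => rw [smul_mul_assoc, hx]
    | add x y _ _ hx hy => rw [add_mul, hx, hy]
  have hw : ∀ v ∈ V, v ≠ 0 → v ≠ o → wt v = 2 * h := by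
    intro v hv h0 hvo
    obtain ⟨r, hr⟩ := hdiv v hv
    have h1 : wt v ≤ 2 * (2 * h) := by
      have := wt_mul_le o v
      rwa [mul_comm, hcovV v hv, hwo] at this
    have h2 := wt_pos.2 h0
    have h3 : wt v ≠ 2 * (2 * h) := fun h4 => hvo (by
      rw [← hcovV v hv, mul_comm]
      exact mul_eq_left_of_card_eq_two hq fun i => support_subset_of_wt_mul_eq (by
        rw [mul_comm, hcovV v hv, h4, hwo]))
    rw [hr] at h1 h2 h3 ⊢
    have h4 : r ≤ 2 := by
      have := Nat.le_of_mul_le_mul_left (by linarith : 2 * h * r ≤ 2 * h * 2) (by omega)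
      exact this
    interval_cases r <;> omega
  obtain ⟨k, hk⟩ : ∃ k, Nat.card V = 2 ^ k :=
    ⟨_, by rw [Module.natCard_eq_pow_finrank (K := F), Nat.card_eq_fintype_card, hq]⟩
  -- The five words `b + a₀` and `o` show that `V` has dimension at least three.
  have hk3 : 3 ≤ k := by
    have h1 : (↑(insert o (A.image fun b => b + a₀)) : Set (ι → F)) ⊆ V := by
      intro v hv
      simp only [Finset.coe_insert, Finset.coe_image, Set.mem_insert_iff, Set.mem_image,
        Finset.mem_coe] at hv
      rcases hv with rfl | ⟨b, hb, rfl⟩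
      · exact hoV
      · exact hA.add_mem b hb a₀ ha₀
    have h2 := Set.ncard_le_ncard h1 (Set.toFinite _)
    rw [Set.ncard_coe_finset, Finset.card_insert_of_notMem,
      Finset.card_image_of_injective _ (add_left_injective a₀), hcard] at h2
    · have h3 : (V : Set (ι → F)).ncard = 2 ^ k := hk
      rw [h3] at h2
      by_contra h4
      have : 2 ^ k ≤ 2 ^ 2 := Nat.pow_le_pow_right two_pos (by omega)
      omega
    · intro hmem
      obtain ⟨b, hb, hbo⟩ := Finset.mem_image.1 hmem
      have h3 : wt (b + a₀) ≤ 2 * h := by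
        by_cases hba : b = a₀
        · rw [hba, add_self_of_card_eq_two hq, wt_zero]
          omega
        · rw [wt_add_of_mul_eq_zero (hA.mul_eq_zero b hb a₀ ha₀ hba), hA.wt_eq b hb,
            hA.wt_eq a₀ ha₀]
          omega
      rw [hbo, hwo] at h3
      omega
  -- The words vanishing at a position of the support of `o` form a code of constant weight.
  obtain ⟨i, hi⟩ : ∃ i, o i ≠ 0 := Function.ne_iff.1 (wt_pos.1 (by rw [hwo]; omega))
  have hdvd : Fintype.card F ^ (k - 1 - 1) ∣ 2 * h := by
    refine pow_dvd_of_constant_weight (V ⊓ LinearMap.ker (LinearMap.proj i)) ?_ (by omega) ?_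
    · intro v hv h0
      refine hw v hv.1 h0 ?_
      rintro rfl
      exact hi hv.2
    · have h1 := natCard_fiber_mul_card (LinearMap.proj i ∘ₗ V.subtype) (fun h0 =>
        hi (LinearMap.congr_fun h0 ⟨o, hoV⟩)) 0
      obtain ⟨m, rfl⟩ := Nat.exists_eq_add_of_le' (show 1 ≤ k by omega)
      rw [hk, hq, pow_succ] at h1
      rw [hq, Nat.add_sub_cancel, ← Nat.eq_of_mul_eq_mul_right two_pos h1]
      refine Nat.card_congr
        { toFun := fun v => ⟨⟨v.1, v.2.1⟩, v.2.2⟩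
          invFun := fun v => ⟨v.1.1, v.1.2, v.2⟩
          left_inv := fun _ => rfl
          right_inv := fun _ => rfl }
  have hadm : (Block.reedMuller k).IsAdmissible (Fintype.card F) a :=
    ⟨hq, hk3, by have := ha.2 hdvd; omega⟩
  exact ⟨k, hadm, isBlockCopy_reedMuller (by omega) ha.1 hadm hk hoV hwo hw⟩

end Binary

section Recognition

variable {F : Type u} {ι : Type*} [Field F] [Fintype F] [Finite ι]

/-- A connected code in which overlapping is transitive on the words of weight `Δ` is a repeated
simplex code. -/
lemma exists_isBlockCopy_simplex {Δ a : ℕ} (hΔ : 0 < Δ)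
    (ha : IsGreatest {m : ℕ | Fintype.card F ^ m ∣ Δ} a)
    {V : Submodule F (ι → F)} (hdiv : ∀ c ∈ V, Δ ∣ wt c)
    (hspan : Submodule.span F (minWords Δ V) = V) (hne : (minWords Δ V).Nonempty)
    (hconn : IsConnectedCode Δ V)
    (htrans : ∀ x ∈ minWords Δ V, ∀ y ∈ minWords Δ V, ∀ z ∈ minWords Δ V,
      x * y ≠ 0 → y * z ≠ 0 → x * z ≠ 0) :
    ∃ k, (Block.simplex k).IsAdmissible (Fintype.card F) a ∧
      IsBlockCopy Δ V (Block.simplex k) := by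
  have hn0 : ∀ x ∈ minWords Δ V, x ≠ 0 := fun x hx => wt_pos.1 (by rw [hx.2]; exact hΔ)
  have hw : ∀ v ∈ V, v ≠ 0 → wt v = Δ := by
    refine wt_eq_of_pairwise_overlapping hdiv hspan fun x hx y hy => ?_
    refine (hconn {y ∈ minWords Δ V | x * y ≠ 0} (fun y hy => hy.1) ⟨x, hx, ?_⟩ ?_ hy).2
    · exact fun h0 => hn0 x hx (eq_zero_of_mul_self_eq_zero h0)
    · exact fun y hy z hz hyz => ⟨hz, htrans x hx y hy.1 z hz hy.2 hyz⟩
  obtain ⟨k, hk⟩ : ∃ k, Nat.card V = Fintype.card F ^ k :=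
    ⟨_, by rw [Module.natCard_eq_pow_finrank (K := F), Nat.card_eq_fintype_card]⟩
  have hk1 : 1 ≤ k := by
    obtain ⟨x, hx⟩ := hne
    have : Nontrivial V := ⟨⟨x, hx.1⟩, 0, fun h => hn0 x hx (congrArg Subtype.val h)⟩
    have h1 : 1 < Nat.card V := Finite.one_lt_card
    by_contra h0
    obtain rfl : k = 0 := by omega
    simp [hk] at h1
  have hadm : (Block.simplex k).IsAdmissible (Fintype.card F) a :=
    ⟨hk1, by have := ha.2 (pow_dvd_of_constant_weight V hw hk1 hk); omega⟩
  exact ⟨k, hadm, isBlockCopy_simplex hΔ ha.1 hadm hk hw⟩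

/-- Every connected divisible code spanned by its words of weight `Δ` is a building block. -/
theorem exists_isBlockCopy_of_isConnectedCode {Δ a : ℕ} (hΔ : 0 < Δ)
    (ha : IsGreatest {m : ℕ | Fintype.card F ^ m ∣ Δ} a)
    {V : Submodule F (ι → F)} (hdiv : ∀ c ∈ V, Δ ∣ wt c)
    (hspan : Submodule.span F (minWords Δ V) = V) (hne : (minWords Δ V).Nonempty)
    (hconn : IsConnectedCode Δ V) :
    ∃ b : Block, b.IsAdmissible (Fintype.card F) a ∧ IsBlockCopy Δ V b := by
  classical
  by_cases htrans : ∀ x ∈ minWords Δ V, ∀ y ∈ minWords Δ V, ∀ z ∈ minWords Δ V,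
      x * y ≠ 0 → y * z ≠ 0 → x * z ≠ 0
  · obtain ⟨k, hk⟩ := exists_isBlockCopy_simplex hΔ ha hdiv hspan hne hconn htrans
    exact ⟨_, hk⟩
  push Not at htrans
  obtain ⟨x, hx, y, hy, z, hz, hxy, hyz, hxz⟩ := htrans
  have hq : Fintype.card F = 2 := by
    have h1 := Fintype.one_lt_card (α := F)
    by_contra h2
    exact mul_ne_zero_of_overlapping (by omega) hΔ hdiv hx hy hz hxy hyz hxz
  obtain ⟨h, rfl⟩ : 2 ∣ Δ :=
    ⟨_, (wt_of_overlapping_binary hq hdiv hx hy hxy (by rintro rfl; exact hyz hxz)).symm⟩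
  have hh : 0 < h := by omega
  obtain ⟨A₀, hA₀, hcard₀⟩ := exists_frame_card_eq_four hq hh hdiv hx hy hz hxy hyz hxz
  obtain ⟨A, hle, hA⟩ := Set.Finite.exists_le_maximal (s := {A | IsFrame h V A})
    (Set.toFinite _) hA₀
  have hcard : 4 ≤ A.card := hcard₀ ▸ Finset.card_le_card hle
  have hcases := fun u (hu : u ∈ minWords (2 * h) V) =>
    IsFrame.cases_of_maximal hq hh hdiv hA.prop hcard
      (fun w hw hf => hw (hA.le_of_ge hf (Finset.subset_insert w A)
        (Finset.mem_insert_self w A))) hu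
  have hadd : ∀ b ∈ A, ∀ c ∈ A, b ≠ c → b + c ∈ minWords (2 * h) V := by
    intro b hb c hc hbc
    refine ⟨hA.prop.add_mem b hb c hc, ?_⟩
    rw [wt_add_of_mul_eq_zero (hA.prop.mul_eq_zero b hb c hc hbc), hA.prop.wt_eq b hb,
      hA.prop.wt_eq c hc, two_mul]
  have hdisj : ∀ u, (∀ b ∈ A, u * b = 0) → u * ∑ b ∈ A, b = 0 := fun u hu => by
    rw [Finset.mul_sum]
    exact Finset.sum_eq_zero hu
  have hsum : ∀ b ∈ A, b * ∑ c ∈ A, c = b := by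
    intro b hb
    rw [Finset.mul_sum, Finset.sum_eq_single_of_mem b hb, mul_self_of_card_eq_two hq]
    exact fun c hc hcb => hA.prop.mul_eq_zero b hb c hc hcb.symm
  obtain ⟨b₀, hb₀, c₀, hc₀, hbc₀⟩ := Finset.one_lt_card.1 (show 1 < A.card by omega)
  by_cases h4 : A.card = 4
  · -- The words covered by the frame are closed under overlapping.
    obtain ⟨k, hk⟩ := hA.prop.exists_isBlockCopy_reedMuller hq hh ha hdiv hspan h4 fun u hu => by
      refine (hconn {u ∈ minWords (2 * h) V | u * ∑ b ∈ A, b = u} (fun u hu => hu.1)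
        ⟨b₀ + c₀, hadd b₀ hb₀ c₀ hc₀ hbc₀, ?_⟩ ?_ hu).2
      · rw [add_mul, hsum b₀ hb₀, hsum c₀ hc₀]
      · intro u hu v hv huv
        refine ⟨hv, ?_⟩
        rcases hcases v hv with h1 | ⟨b, hb, c, hc, -, rfl⟩ | h1
        · refine absurd ?_ huv
          rw [← hu.2, mul_assoc, mul_comm _ v, hdisj v h1, mul_zero]
        · rw [add_mul, hsum b hb, hsum c hc]
        · exact h1.2
    exact ⟨_, hk⟩
  · -- The pairwise sums of the frame are closed under overlapping.
    obtain ⟨k, hk⟩ := Nat.exists_eq_add_of_le' (show 1 ≤ A.card by omega)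
    refine ⟨Block.parityCheck k, ⟨hq, ha.2 ?_, by omega⟩,
      hA.prop.isBlockCopy_parityCheck hq hh hspan hk fun u hu => ?_⟩
    · change Fintype.card F ^ 1 ∣ 2 * h
      rw [hq, pow_one]
      exact Dvd.intro _ rfl
    · refine (hconn {u ∈ minWords (2 * h) V | ∃ a ∈ A, ∃ b ∈ A, a ≠ b ∧ u = a + b}
        (fun u hu => hu.1) ⟨b₀ + c₀, hadd b₀ hb₀ c₀ hc₀ hbc₀, b₀, hb₀, c₀, hc₀, hbc₀, rfl⟩ ?_ hu).2
      rintro u ⟨-, b, hb, c, hc, -, rfl⟩ v hv huv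
      refine ⟨hv, ?_⟩
      rcases hcases v hv with h1 | h1 | h1
      · refine absurd ?_ huv
        rw [mul_comm, mul_add, h1 b hb, h1 c hc, add_zero]
      · exact h1
      · exact absurd h1.1 h4

end Recognition

/-! ### Decomposition into connected codes -/

section Decomposition

variable {F ι : Type*} [Field F]

lemma mul_eq_zero_of_mem_span {S T : Set (ι → F)} (h : ∀ x ∈ S, ∀ y ∈ T, x * y = 0)
    {x y : ι → F} (hx : x ∈ Submodule.span F S) (hy : y ∈ Submodule.span F T) : x * y = 0 := by
  induction hx using Submodule.span_induction with
  | zero => rw [zero_mul]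
  | smul t x _ hx => rw [smul_mul_assoc, hx, smul_zero]
  | add x x' _ _ hx hx' => rw [add_mul, hx, hx', add_zero]
  | mem x hx =>
    induction hy using Submodule.span_induction with
    | zero => rw [mul_zero]
    | smul t y _ hy => rw [mul_smul_comm, hy, smul_zero]
    | add y y' _ _ hy hy' => rw [mul_add, hy, hy', add_zero]
    | mem y hy => exact h x hx y hy

variable [Finite F] [Finite ι]

/-- A code spanned by its words of weight `Δ` is the sum of connected codes with pairwise disjoint
supports: the spans of the connected components of the graph of overlapping words. -/
lemma exists_connected_decomposition {Δ : ℕ} (hΔ : 0 < Δ) (C : Submodule F (ι → F))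
    (hspan : Submodule.span F (minWords Δ C) = C) :
    ∃ (s : ℕ) (V : Fin s → Submodule F (ι → F)),
      (∀ i, Submodule.span F (minWords Δ (V i)) = V i ∧ (minWords Δ (V i)).Nonempty ∧
        IsConnectedCode Δ (V i)) ∧
      (∀ i j, i ≠ j → ∀ x ∈ V i, ∀ y ∈ V j, x * y = 0) ∧ ⨆ i, V i = C := by
  let r : minWords Δ C → minWords Δ C → Prop := fun x y => (x : ι → F) * y ≠ 0
  let I := Quotient (Relation.EqvGen.setoid r)
  let cls : minWords Δ C → I := Quotient.mk _
  have hcls : ∀ x y, cls x = cls y ↔ Relation.EqvGen r x y := fun x y => Quotient.eq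
  let W : I → Set (ι → F) := fun c => {x | ∃ hx : x ∈ minWords Δ C, cls ⟨x, hx⟩ = c}
  have hW : ∀ c d, c ≠ d → ∀ x ∈ Submodule.span F (W c), ∀ y ∈ Submodule.span F (W d),
      x * y = 0 := by
    refine fun c d hcd x hx y hy => mul_eq_zero_of_mem_span ?_ hx hy
    rintro x ⟨hx, rfl⟩ y ⟨hy, rfl⟩
    by_contra hxy
    exact hcd ((hcls _ _).2 (Relation.EqvGen.rel _ _ hxy))
  have hle : ∀ c, Submodule.span F (W c) ≤ C := fun c => by
    rw [Submodule.span_le]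
    rintro x ⟨hx, -⟩
    exact hx.1
  have hmin : ∀ c, minWords Δ (Submodule.span F (W c)) = W c := by
    intro c
    apply Set.Subset.antisymm
    · intro x hx
      have hxC : x ∈ minWords Δ C := ⟨hle c hx.1, hx.2⟩
      refine ⟨hxC, ?_⟩
      by_contra hne
      have h1 := hW _ _ hne x (Submodule.subset_span ⟨hxC, rfl⟩) x hx.1
      have h2 := hx.2
      rw [eq_zero_of_mul_self_eq_zero h1, wt_zero] at h2
      omega
    · rintro x ⟨hx, hc⟩
      exact ⟨Submodule.subset_span ⟨hx, hc⟩, hx.2⟩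
  have hIfin : Finite I := Quotient.finite _
  obtain ⟨s, ⟨e⟩⟩ := Finite.exists_equiv_fin I
  refine ⟨s, fun i => Submodule.span F (W (e.symm i)), fun i => ⟨?_, ?_, ?_⟩, ?_, ?_⟩
  · rw [hmin]
  · rw [hmin]
    obtain ⟨⟨x, hx⟩, h⟩ := Quotient.exists_rep (e.symm i)
    exact ⟨x, hx, h⟩
  · intro S hS hne hcl
    rw [hmin] at hS hcl ⊢
    have key : ∀ x y, Relation.EqvGen r x y → ((x : ι → F) ∈ S ↔ (y : ι → F) ∈ S) := by
      intro x y hxy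
      induction hxy with
      | refl x => exact Iff.rfl
      | symm x y _ ih => exact ih.symm
      | trans x y z _ _ h1 h2 => exact h1.trans h2
      | rel x y h =>
        have hc : cls x = cls y := (hcls _ _).2 (Relation.EqvGen.rel _ _ h)
        constructor
        · intro hx
          obtain ⟨_, hxc⟩ := hS hx
          exact hcl x hx y ⟨y.2, hc ▸ hxc⟩ h
        · intro hy
          obtain ⟨_, hyc⟩ := hS hy
          exact hcl y hy x ⟨x.2, hc.symm ▸ hyc⟩ (by rw [mul_comm]; exact h)
    obtain ⟨x, hx⟩ := hne
    rintro y ⟨hy, hyc⟩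
    obtain ⟨hx', hxc⟩ := hS hx
    exact (key ⟨x, hx'⟩ ⟨y, hy⟩ ((hcls _ _).1 (hxc.trans hyc.symm))).1 hx
  · intro i j hij
    exact hW _ _ fun h => hij (e.symm.injective h)
  · apply le_antisymm
    · exact iSup_le fun i => hle _
    · conv_lhs => rw [← hspan]
      rw [Submodule.span_le]
      intro x hx
      refine Submodule.mem_iSup_of_mem (e (cls ⟨x, hx⟩)) (Submodule.subset_span ⟨hx, ?_⟩)
      rw [Equiv.symm_apply_apply]

end Decomposition

/-! ### Direct sums and code isomorphisms -/

section DirectSum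

variable {F : Type u} [Field F]

lemma mem_directSum {s : ℕ} {κ : Fin s → Type*} {D : ∀ i, Submodule F (κ i → F)}
    {d : (Σ i, κ i) → F} : d ∈ directSum D ↔ ∀ i, (fun x => d ⟨i, x⟩) ∈ D i := by
  rw [directSum, Submodule.mem_iInf]
  rfl

/-- The words of a direct sum are the families of words of the summands. -/
def directSumEquiv {s : ℕ} {κ : Fin s → Type*} (D : ∀ i, Submodule F (κ i → F)) :
    directSum D ≃ₗ[F] (∀ i, D i) where
  toFun d i := ⟨fun x => d.1 ⟨i, x⟩, mem_directSum.1 d.2 i⟩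
  invFun v := ⟨fun p => (v p.1).1 p.2, mem_directSum.2 fun i => (v i).2⟩
  left_inv _ := rfl
  right_inv _ := rfl
  map_add' _ _ := rfl
  map_smul' _ _ := rfl

lemma wt_eq_sum_wt_directSumEquiv {s : ℕ} {κ : Fin s → Type*} [∀ i, Finite (κ i)]
    (D : ∀ i, Submodule F (κ i → F)) (d : directSum D) :
    wt (d : (Σ i, κ i) → F) = ∑ i, wt (directSumEquiv D d i : κ i → F) := by
  simp only [wt_eq_natCard]
  rw [← Nat.card_sigma]
  exact Nat.card_congr
    { toFun := fun p => ⟨p.1.1, p.1.2, p.2⟩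
      invFun := fun p => ⟨⟨p.1, p.2.1⟩, p.2.2⟩
      left_inv := fun _ => rfl
      right_inv := fun _ => rfl }

lemma mem_extendByZeros {κ : Type*} {z : ℕ} {D : Submodule F (κ → F)} {c : κ ⊕ Fin z → F} :
    c ∈ extendByZeros z D ↔ (fun j => c (Sum.inl j)) ∈ D ∧ ∀ j, c (Sum.inr j) = 0 := by
  rw [extendByZeros, Submodule.mem_inf, LinearMap.mem_ker]
  exact and_congr Iff.rfl funext_iff

/-- The words of `extendByZeros z D` are the words of `D` extended by zero. -/
def extendMap {κ : Type*} (z : ℕ) (D : Submodule F (κ → F)) : D →ₗ[F] (κ ⊕ Fin z → F) where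
  toFun d := Sum.elim d.1 0
  map_add' d d' := by
    ext (j | j) <;> simp
  map_smul' t d := by
    ext (j | j) <;> simp

lemma wt_extendMap {κ : Type*} (z : ℕ) (D : Submodule F (κ → F)) (d : D) :
    wt (extendMap z D d) = wt (d : κ → F) := by
  symm
  rw [wt_eq_natCard, wt_eq_natCard]
  refine Nat.card_congr (Equiv.ofBijective (fun p => ⟨Sum.inl p.1, p.2⟩) ⟨?_, ?_⟩)
  · intro p p' h
    exact Subtype.ext (Sum.inl_injective (congrArg Subtype.val h))
  · rintro ⟨j | j, hj⟩
    · exact ⟨⟨j, hj⟩, rfl⟩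
    · exact absurd rfl hj

/-- A code that is the image of a code `D` without zero positions under a weight-preserving linear
map is isomorphic to `D`, up to zero positions. -/
lemma codeIso_of_isometry [Fintype F] {ι κ : Type*} [Finite ι] [Finite κ] {C : Submodule F (ι → F)}
    {D : Submodule F (κ → F)} (hfull : ∀ j, ∃ d ∈ D, d j ≠ 0) (φ : D →ₗ[F] (ι → F))
    (hφ : ∀ d, wt (φ d) = wt (d : κ → F)) (hC : LinearMap.range φ = C) :
    ∃ z : ℕ, CodeIso C (extendByZeros z D) := by
  have h1 := natCard_nonzero_positions_eq φ D.subtype hφ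
  have h2 : Nat.card {j // ∃ d : D, D.subtype d j ≠ 0} = Nat.card κ :=
    Nat.card_congr (Equiv.subtypeUnivEquiv fun j => by
      obtain ⟨d, hd, hj⟩ := hfull j
      exact ⟨⟨d, hd⟩, hj⟩)
  have h3 : Nat.card κ ≤ Nat.card ι := by
    rw [← h2, ← h1]
    exact Finite.card_subtype_le _
  refine ⟨Nat.card ι - Nat.card κ, ?_⟩
  set z := Nat.card ι - Nat.card κ with hz
  obtain ⟨e, u, heu⟩ := exists_monomial_of_wt_eq φ (extendMap z D)
    (fun d => by rw [hφ, wt_extendMap]) (by rw [Nat.card_sum, Nat.card_fin]; omega)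
  refine ⟨e, u, RingEquiv.refl F, fun c' => ?_⟩
  rw [mem_extendByZeros]
  constructor
  · rintro ⟨h4, h5⟩
    refine ⟨φ ⟨_, h4⟩, hC ▸ LinearMap.mem_range_self φ _, fun i => ?_⟩
    rw [RingEquiv.refl_apply, ← heu]
    rcases e i with j | j
    · rfl
    · exact h5 j
  · rintro ⟨c, hc, hcc⟩
    rw [← hC] at hc
    obtain ⟨d, rfl⟩ := hc
    have h6 : c' = extendMap z D d := by
      ext j
      obtain ⟨i, rfl⟩ := e.surjective j
      rw [hcc, heu, RingEquiv.refl_apply]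
    rw [h6]
    exact ⟨d.2, fun j => rfl⟩

end DirectSum

/-! ### Existence of the decomposition -/

section Existence

variable {F : Type u} {ι : Type*} [Field F] [Fintype F] [Finite ι]

/-- A divisible code spanned by its words of weight `Δ` is a direct sum of building blocks. -/
theorem exists_isDirectSumOfBlocks {Δ a : ℕ} (hΔ : 0 < Δ)
    (ha : IsGreatest {m : ℕ | Fintype.card F ^ m ∣ Δ} a)
    {C : Submodule F (ι → F)} (hdiv : ∀ c ∈ C, Δ ∣ wt c)
    (hspan : Submodule.span F (minWords Δ C) = C) :
    ∃ (s : ℕ) (b : Fin s → Block), (∀ i, (b i).IsAdmissible (Fintype.card F) a) ∧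
      IsDirectSumOfBlocks Δ C b := by
  obtain ⟨s, V, hV, hdisj, hsup⟩ := exists_connected_decomposition hΔ C hspan
  have hle : ∀ i, V i ≤ C := fun i => hsup ▸ le_iSup V i
  choose b hadm φ hφ hrange using fun i => exists_isBlockCopy_of_isConnectedCode hΔ ha
    (fun c hc => hdiv c (hle i hc)) (hV i).1 (hV i).2.1 (hV i).2.2
  refine ⟨s, b, hadm, ?_⟩
  have hmem : ∀ i d, φ i d ∈ V i := fun i d => hrange i ▸ LinearMap.mem_range_self _ _
  let Φ : (∀ i, (b i).code F Δ) →ₗ[F] (ι → F) := ∑ i, φ i ∘ₗ LinearMap.proj i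
  have hΦ : ∀ d, Φ d = ∑ i, φ i (d i) := fun d => by simp [Φ]
  refine codeIso_of_isometry ?_ (Φ ∘ₗ (directSumEquiv _).toLinearMap) (fun d => ?_) ?_
  · classical
    rintro ⟨i, p⟩
    obtain ⟨c, hc, hcp⟩ := Block.code_full (hadm i) p
    let v : ∀ i, (b i).code F Δ := Pi.single i ⟨c, hc⟩
    refine ⟨(directSumEquiv _).symm v, Subtype.prop _, ?_⟩
    have h1 : (v i : _ → F) p = c p := by simp [v]
    exact h1 ▸ hcp
  · rw [wt_eq_sum_wt_directSumEquiv, LinearMap.comp_apply, hΦ, wt_sum_of_mul_eq_zero]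
    · exact Finset.sum_congr rfl fun i _ => hφ i _
    · exact fun i _ j _ hij => hdisj i j hij _ (hmem i _) _ (hmem j _)
  · rw [LinearMap.range_comp_of_range_eq_top _ (LinearEquiv.range _), ← hsup]
    apply le_antisymm
    · rintro _ ⟨d, rfl⟩
      rw [hΦ]
      exact Submodule.sum_mem _ fun i _ => Submodule.mem_iSup_of_mem i (hmem i _)
    · classical
      refine iSup_le fun i => ?_
      rw [← hrange i]
      rintro _ ⟨d, rfl⟩
      refine ⟨Pi.single i d, ?_⟩
      rw [hΦ, Finset.sum_eq_single i]
      · simp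
      · intro j _ hj
        simp [hj]
      · simp

end Existence

/-! ### An invariant of words of weight `Δ` -/

section Invariant

variable {A B : Type*} [AddCommGroup A] [AddCommGroup B]

/-- The words of weight `Δ` that overlap the word `v` of weight `Δ`; overlapping is expressed by the
weight function, as disjoint words have a sum of weight `2 * Δ`. -/
def neighbours (w : A → ℕ) (Δ : ℕ) (v : A) : Set A := {u | w u = Δ ∧ w (u + v) ≠ 2 * Δ}

/-- The additive span of the neighbours of `v`; in a direct sum of building blocks this is the
summand containing `v`. -/
def neighbourGroup (w : A → ℕ) (Δ : ℕ) (v : A) : AddSubgroup A :=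
  AddSubgroup.closure (neighbours w Δ v)

/-- The size of the additive span of the neighbours of `v`, and the number of its nonzero members
of weight other than `Δ`, cut off at `2`. The second component tells apart the three families of
building blocks, the first one their dimensions. -/
noncomputable def wordType (w : A → ℕ) (Δ : ℕ) (v : A) : ℕ × ℕ :=
  (Nat.card (neighbourGroup w Δ v),
    min 2 {c | c ∈ neighbourGroup w Δ v ∧ c ≠ 0 ∧ w c ≠ Δ}.ncard)

/-- The number of words of weight `Δ` and given type. -/
noncomputable def typeCount (w : A → ℕ) (Δ : ℕ) (τ : ℕ × ℕ) : ℕ :=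
  Nat.card {v // w v = Δ ∧ wordType w Δ v = τ}

lemma wordType_eq_of_neighbours {w : A → ℕ} {w' : B → ℕ} {Δ : ℕ} (j : A →+ B)
    (hj : Function.Injective j) (hw : ∀ a, w' (j a) = w a) {v : A}
    (hN : neighbours w' Δ (j v) = j '' neighbours w Δ v) :
    wordType w' Δ (j v) = wordType w Δ v := by
  have hG : neighbourGroup w' Δ (j v) = (neighbourGroup w Δ v).map j := by
    rw [neighbourGroup, hN, neighbourGroup, AddMonoidHom.map_closure]
  refine Prod.ext ?_ (congrArg (min 2) ?_)
  · change Nat.card (neighbourGroup w' Δ (j v)) = Nat.card (neighbourGroup w Δ v)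
    rw [hG]
    exact (Nat.card_congr ((neighbourGroup w Δ v).equivMapOfInjective j hj).toEquiv).symm
  · rw [hG, ← Set.ncard_image_of_injective _ hj]
    congr 1
    ext c
    constructor
    · rintro ⟨⟨a, ha, rfl⟩, h1, h2⟩
      exact ⟨a, ⟨ha, fun h => h1 (by rw [h, map_zero]), by rwa [hw] at h2⟩, rfl⟩
    · rintro ⟨a, ⟨ha, h1, h2⟩, rfl⟩
      exact ⟨⟨a, ha, rfl⟩, fun h => h1 ((map_eq_zero_iff j hj).1 h), by rwa [hw]⟩

lemma wordType_addEquiv {w : A → ℕ} {w' : B → ℕ} (Δ : ℕ) (e : A ≃+ B)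
    (hw : ∀ a, w' (e a) = w a) (v : A) : wordType w' Δ (e v) = wordType w Δ v := by
  refine wordType_eq_of_neighbours e.toAddMonoidHom e.injective hw ?_
  ext b
  obtain ⟨a, rfl⟩ := e.surjective b
  change w' (e a) = Δ ∧ w' (e a + e v) ≠ 2 * Δ ↔ e a ∈ e '' neighbours w Δ v
  rw [e.injective.mem_set_image, ← map_add, hw, hw]
  rfl

lemma typeCount_addEquiv {w : A → ℕ} {w' : B → ℕ} (Δ : ℕ) (e : A ≃+ B)
    (hw : ∀ a, w' (e a) = w a) (τ : ℕ × ℕ) : typeCount w Δ τ = typeCount w' Δ τ :=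
  Nat.card_congr (e.toEquiv.subtypeEquiv fun a => by
    change _ ↔ w' (e a) = Δ ∧ wordType w' Δ (e a) = τ
    rw [hw, wordType_addEquiv Δ e hw])

end Invariant

section Pi

variable {s : ℕ} {A : Fin s → Type*} [∀ i, AddCommGroup (A i)] {w : ∀ i, A i → ℕ} {Δ : ℕ}

/-- The weight function of a direct sum. -/
def sumWeight (w : ∀ i, A i → ℕ) (v : ∀ i, A i) : ℕ := ∑ i, w i (v i)

lemma sumWeight_single (hw0 : ∀ i, w i 0 = 0) (i : Fin s) (x : A i) :
    sumWeight w (Pi.single i x) = w i x := by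
  rw [sumWeight]
  rw [Finset.sum_eq_single i]
  · simp
  · intro j _ hj
    simp [hj, hw0]
  · simp

lemma exists_eq_single_of_weight_eq (hΔ : 0 < Δ) (hw0 : ∀ i, w i 0 = 0)
    (hmin : ∀ i x, x ≠ 0 → Δ ≤ w i x) {v : ∀ i, A i} (hv : sumWeight w v = Δ) :
    ∃ i, v = Pi.single i (v i) ∧ w i (v i) = Δ := by
  obtain ⟨i, hi⟩ : ∃ i, v i ≠ 0 := by
    by_contra! h
    simp [sumWeight, h, hw0] at hv
    omega
  have h1 := hmin i _ hi
  rw [sumWeight, ← Finset.add_sum_erase _ _ (Finset.mem_univ i)] at hv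
  have h2 : ∀ j, j ≠ i → v j = 0 := by
    intro j hj
    by_contra h
    have h3 : w j (v j) ≤ ∑ x ∈ Finset.univ.erase i, w x (v x) :=
      Finset.single_le_sum (f := fun j => w j (v j)) (fun _ _ => Nat.zero_le _) (by simp [hj])
    have h4 := hmin j _ h
    omega
  have h3 : v = Pi.single i (v i) := by
    ext j
    by_cases hj : j = i
    · subst hj
      simp
    · rw [h2 j hj, Pi.single_eq_of_ne hj]
  refine ⟨i, h3, ?_⟩
  omega

/-- In a direct sum of spaces of minimum weight at least `Δ`, the words of weight `Δ` are those of
the summands, with the same neighbours. So the numbers of words of a given type add up. -/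
lemma typeCount_pi [∀ i, Finite (A i)] (hΔ : 0 < Δ) (hw0 : ∀ i, w i 0 = 0)
    (hmin : ∀ i x, x ≠ 0 → Δ ≤ w i x) (τ : ℕ × ℕ) :
    typeCount (sumWeight w) Δ τ = ∑ i, typeCount (w i) Δ τ := by
  classical
  have hne : ∀ i (x : A i), w i x = Δ → x ≠ 0 := by
    rintro i x hx rfl
    rw [hw0] at hx
    omega
  have htype : ∀ i (x : A i), w i x = Δ →
      wordType (sumWeight w) Δ (Pi.single i x) = wordType (w i) Δ x := by
    intro i x hx
    refine wordType_eq_of_neighbours (AddMonoidHom.single A i) (Pi.single_injective i)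
      (sumWeight_single hw0 i) ?_
    ext v
    constructor
    · rintro ⟨h1, h2⟩
      obtain ⟨j, hj, hwj⟩ := exists_eq_single_of_weight_eq hΔ hw0 hmin h1
      generalize v j = y at hj hwj
      subst hj
      by_cases hij : j = i
      · subst hij
        refine ⟨y, ⟨hwj, ?_⟩, rfl⟩
        rwa [AddMonoidHom.single_apply, ← Pi.single_add, sumWeight_single hw0] at h2
      · refine absurd ?_ h2
        rw [two_mul]
        have h3 : ∀ l, w l ((Pi.single j y + AddMonoidHom.single A i x : ∀ i, A i) l)
            = w l ((Pi.single j y : ∀ i, A i) l) + w l ((Pi.single i x : ∀ i, A i) l) := by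
          intro l
          rw [AddMonoidHom.single_apply, Pi.add_apply]
          by_cases hl : l = j
          · subst hl
            rw [Pi.single_eq_of_ne hij, add_zero, hw0, add_zero]
          · rw [Pi.single_eq_of_ne hl, zero_add, hw0, zero_add]
        rw [sumWeight, Finset.sum_congr rfl fun l _ => h3 l, Finset.sum_add_distrib]
        exact congrArg₂ _ ((sumWeight_single hw0 j y).trans hwj)
          ((sumWeight_single hw0 i x).trans hx)
    · rintro ⟨y, ⟨h1, h2⟩, rfl⟩
      refine ⟨(sumWeight_single hw0 i y).trans h1, ?_⟩
      rwa [AddMonoidHom.single_apply, AddMonoidHom.single_apply, ← Pi.single_add,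
        sumWeight_single hw0]
  unfold typeCount
  rw [← Nat.card_sigma]
  symm
  refine Nat.card_congr (Equiv.ofBijective (fun p => ⟨Pi.single p.1 p.2.1, ?_, ?_⟩) ⟨?_, ?_⟩)
  · rw [sumWeight_single hw0, p.2.2.1]
  · rw [htype _ _ p.2.2.1, p.2.2.2]
  · rintro ⟨i, x, hx, hx'⟩ ⟨j, y, hy, hy'⟩ h
    have h1 : (Pi.single i x : ∀ i, A i) = Pi.single j y := congrArg Subtype.val h
    by_cases hij : i = j
    · subst hij
      obtain rfl := Pi.single_injective i h1
      rfl
    · have h2 := congrFun h1 i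
      rw [Pi.single_eq_same, Pi.single_eq_of_ne hij] at h2
      exact absurd h2 (hne i x hx)
  · rintro ⟨v, hv, hv'⟩
    obtain ⟨i, hi, hwi⟩ := exists_eq_single_of_weight_eq hΔ hw0 hmin hv
    refine ⟨⟨i, v i, hwi, ?_⟩, Subtype.ext hi.symm⟩
    rw [← htype i _ hwi, ← hi, hv']

end Pi

/-! ### The invariant of the building blocks -/

section BlockType

variable {F : Type u} [Field F] [Fintype F]

/-- The common type of the words of weight `Δ` of a building block. -/
def Block.type (q : ℕ) : Block → ℕ × ℕ
  | .simplex k => (q ^ k, 0)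
  | .reedMuller k => (q ^ k, 1)
  | .parityCheck k => (q ^ k, 2)

lemma Block.type_injective {q : ℕ} (hq : 1 < q) : Function.Injective (Block.type q) := by
  intro b b' h
  cases b <;> cases b' <;> simp only [Block.type, Prod.mk.injEq] at h <;>
    first
    | exact congrArg _ (Nat.pow_right_injective hq h.1)
    | omega

lemma addSubgroup_eq_top_of_card_lt {A : Type*} [AddGroup A] [Finite A] (H : AddSubgroup A)
    (h : Nat.card A < 2 * Nat.card H) : H = ⊤ := by
  refine AddSubgroup.eq_top_of_card_eq H ?_
  obtain ⟨m, hm⟩ := H.card_addSubgroup_dvd_card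
  have h1 : 0 < Nat.card A := Nat.card_pos
  rw [hm] at h h1 ⊢
  have h2 : m < 2 := by
    by_contra h3
    have : Nat.card H * 2 ≤ Nat.card H * m := Nat.mul_le_mul_left _ (by omega)
    omega
  have h3 : 0 < m := Nat.pos_of_mul_pos_left h1
  obtain rfl : m = 1 := by omega
  rw [mul_one]

variable {A : Type*} [AddCommGroup A] {w : A → ℕ} {Δ : ℕ}

lemma wordType_of_constant_weight (hΔ : 0 < Δ) (hw0 : w 0 = 0) (hw : ∀ a, a ≠ 0 → w a = Δ)
    (v : A) : wordType w Δ v = (Nat.card A, 0) := by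
  have htop : neighbourGroup w Δ v = ⊤ := by
    refine (AddSubgroup.eq_top_iff' _).2 fun a => ?_
    by_cases ha : a = 0
    · rw [ha]
      exact zero_mem _
    · refine AddSubgroup.subset_closure ⟨hw a ha, ?_⟩
      by_cases h : a + v = 0
      · rw [h, hw0]
        omega
      · rw [hw _ h]
        omega
  have hempty : {c : A | c ∈ (⊤ : AddSubgroup A) ∧ c ≠ 0 ∧ w c ≠ Δ} = ∅ := by
    ext c
    simpa using hw c
  rw [wordType, htop, hempty]
  simp

/-- If exactly one nonzero word `o` has weight other than `Δ`, the neighbours of `v` are all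
words but `0`, `o` and `o - v`, too many to lie in a proper subgroup. -/
lemma wordType_of_one_exception [Finite A] (hΔ : 0 < Δ) (hw0 : w 0 = 0) {o : A} (ho : o ≠ 0)
    (hwo : w o = 2 * Δ) (hw : ∀ a, a ≠ 0 → a ≠ o → w a = Δ) (hA : 4 < Nat.card A) (v : A) :
    wordType w Δ v = (Nat.card A, 1) := by
  have hsub : ({o, o - v} : Set A)ᶜ ⊆ neighbourGroup w Δ v := by
    intro a ha
    simp only [Set.mem_compl_iff, Set.mem_insert_iff, Set.mem_singleton_iff, not_or] at ha
    by_cases ha0 : a = 0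
    · rw [ha0]
      exact zero_mem _
    · refine AddSubgroup.subset_closure ⟨hw a ha0 ha.1, ?_⟩
      by_cases h : a + v = 0
      · rw [h, hw0]
        omega
      · rw [hw _ h fun h' => ha.2 (eq_sub_of_add_eq h')]
        omega
  have htop : neighbourGroup w Δ v = ⊤ := by
    refine addSubgroup_eq_top_of_card_lt _ ?_
    have h1 := Set.ncard_le_ncard hsub (Set.toFinite _)
    have h2 := Set.ncard_add_ncard_compl ({o, o - v} : Set A)
    have h3 := Set.ncard_insert_le o {o - v}
    rw [Set.ncard_singleton] at h3
    have h4 : ((neighbourGroup w Δ v : AddSubgroup A) : Set A).ncard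
      = Nat.card (neighbourGroup w Δ v) := rfl
    omega
  have hone : {c : A | c ∈ (⊤ : AddSubgroup A) ∧ c ≠ 0 ∧ w c ≠ Δ} = {o} := by
    ext c
    simp only [AddSubgroup.mem_top, true_and, Set.mem_ofPred_eq, Set.mem_singleton_iff]
    constructor
    · rintro ⟨h1, h2⟩
      by_contra h3
      exact h2 (hw c h1 h3)
    · rintro rfl
      exact ⟨ho, by omega⟩
  rw [wordType, htop, hone]
  simp

end BlockType

section ParityType

variable {F : Type u} [Field F] [Fintype F]

omit [Fintype F] in
lemma wt_single_one {κ : Type*} [DecidableEq κ] (i : κ) : wt (Pi.single i (1 : F)) = 1 := by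
  rw [wt, Pi.support_single_of_ne one_ne_zero, Set.ncard_singleton]

omit [Fintype F] in
lemma wt_pairWord {k : ℕ} {i j : ULift.{u} (Fin (k + 1))} (hij : i ≠ j) :
    wt (pairWord i j : ULift.{u} (Fin (k + 1)) → F) = 2 := by
  have h1 : (pairWord i j : ULift.{u} (Fin (k + 1)) → F)
      = Pi.single i 1 + (-1 : F) • Pi.single j 1 := by
    rw [neg_smul, one_smul, ← sub_eq_add_neg]
    rfl
  rw [h1, wt_add_of_mul_eq_zero, wt_smul (by simp), wt_single_one, wt_single_one]
  ext l
  by_cases hl : l = i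
  · subst hl
    simp [hij]
  · simp [hl]

/-- In the binary parity check code, the neighbours of a word `v` of weight two generate the
code: they include the words of weight two with one position in common with `v`. -/
lemma wordType_parityCheckCode (hq : Fintype.card F = 2) {k h : ℕ} (hk : 4 ≤ k) (hh : 0 < h)
    (v : parityCheckCode F k) (hv : wt (v : ULift.{u} (Fin (k + 1)) → F) = 2) :
    wordType (fun c : parityCheckCode F k => h * wt (c : ULift.{u} (Fin (k + 1)) → F)) (2 * h) v
      = (Fintype.card F ^ k, 2) := by
  set w : parityCheckCode F k → ℕ := fun c => h * wt (c : ULift.{u} (Fin (k + 1)) → F) with hwdef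
  have hw2 : ∀ c, w c = 2 * h ↔ wt (c : ULift.{u} (Fin (k + 1)) → F) = 2 := fun c => by
    rw [hwdef, mul_comm 2 h]
    exact Nat.mul_right_inj hh.ne'
  obtain ⟨i, hi⟩ : ∃ i, (v : ULift.{u} (Fin (k + 1)) → F) i ≠ 0 :=
    Function.ne_iff.1 (wt_pos.1 (by rw [hv]; exact two_pos))
  have hmem : ∀ l, (⟨pairWord i l, pairWord_mem i l⟩ : parityCheckCode F k)
      ∈ neighbourGroup w (2 * h) v := by
    intro l
    by_cases hl : i = l
    · have h0 : (⟨pairWord i l, pairWord_mem i l⟩ : parityCheckCode F k) = 0 := by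
        ext j
        simp [hl, pairWord]
      rw [h0]
      exact zero_mem _
    · refine AddSubgroup.subset_closure ⟨(hw2 _).2 (wt_pairWord hl), ?_⟩
      have h1 := wt_sub_smul_add (pairWord i l) v.1 one_ne_zero
      have h2 : 0 < wt ((pairWord i l : ULift.{u} (Fin (k + 1)) → F) * v.1) := wt_pos.2 fun h0 => by
        have := congrFun h0 i
        simp [pairWord, hl, hi] at this
      have h3 : (pairWord i l : ULift.{u} (Fin (k + 1)) → F) - (1 : F) • v.1
          = pairWord i l + v.1 := by
        rw [one_smul, sub_eq_iff_eq_add, add_assoc, add_self_of_card_eq_two hq, add_zero]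
      rw [wt_pairWord hl, hv, h3] at h1
      have h4 : wt ((pairWord i l : ULift.{u} (Fin (k + 1)) → F) + v.1) < 4 := by omega
      refine ne_of_lt ?_
      change h * wt ((pairWord i l : ULift.{u} (Fin (k + 1)) → F) + v.1) < 2 * (2 * h)
      nlinarith
  have htop : neighbourGroup w (2 * h) v = ⊤ := by
    refine (AddSubgroup.eq_top_iff' _).2 fun c => ?_
    have h1 : c = -∑ l, (c : ULift.{u} (Fin (k + 1)) → F) l •
        (⟨pairWord i l, pairWord_mem i l⟩ : parityCheckCode F k) := by
      ext j
      have h2 := mem_parityCheckCode.1 c.2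
      simp [pairWord, mul_sub, Finset.sum_sub_distrib, h2, Pi.single_apply]
    rw [h1]
    refine neg_mem (sum_mem fun l _ => ?_)
    by_cases hl : (c : ULift.{u} (Fin (k + 1)) → F) l = 0
    · rw [hl, zero_smul]
      exact zero_mem _
    · rw [eq_one_of_card_eq_two hq hl, one_smul]
      exact hmem l
  -- Two words of weight four.
  let p : Fin 5 → ULift.{u} (Fin (k + 1)) := fun m => ⟨Fin.castLE (by omega) m⟩
  have hp : Function.Injective p := by
    intro m m' hm
    exact Fin.castLE_injective (by omega : 5 ≤ k + 1) (congrArg ULift.down hm)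
  let c : Fin 5 → parityCheckCode F k := fun m =>
    ⟨pairWord (p 0) (p 1) + pairWord (p 2) (p m),
      Submodule.add_mem _ (pairWord_mem _ _) (pairWord_mem _ _)⟩
  have hc : ∀ m, m = 3 ∨ m = 4 → c m ∈ {c | c ∈ (⊤ : AddSubgroup (parityCheckCode F k)) ∧ c ≠ 0 ∧
      w c ≠ 2 * h} := by
    intro m hm
    have h1 : ∀ l ∈ ({p 0, p 1, p 2} : Set _), (c m : ULift.{u} (Fin (k + 1)) → F) l ≠ 0 := by
      intro l hl
      simp only [Set.mem_insert_iff, Set.mem_singleton_iff] at hl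
      rcases hl with rfl | rfl | rfl <;> rcases hm with rfl | rfl <;>
        simp [c, pairWord, hp.eq_iff]
    have h2 : 3 ≤ wt (c m : ULift.{u} (Fin (k + 1)) → F) := by
      refine le_trans (le_of_eq ?_) (Set.ncard_le_ncard h1 (Set.toFinite _))
      rw [Set.ncard_eq_three.2 ⟨p 0, p 1, p 2, hp.ne (by decide), hp.ne (by decide),
        hp.ne (by decide), rfl⟩]
    refine ⟨AddSubgroup.mem_top _, fun h0 => ?_, fun h0 => ?_⟩
    · rw [h0] at h2
      simp at h2
    · have := (hw2 _).1 h0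
      omega
  have hne : c 3 ≠ c 4 := by
    intro h0
    have h1 := congrFun (congrArg Subtype.val h0) (p 3)
    simp [c, pairWord, hp.eq_iff] at h1
  rw [wordType, htop]
  refine Prod.ext ?_ (min_eq_left ?_)
  · simp only [AddSubgroup.card_top]
    exact natCard_parityCheckCode k
  · refine (Set.ncard_pair hne).symm.le.trans (Set.ncard_le_ncard ?_ (Set.toFinite _))
    rintro _ (rfl | rfl)
    · exact hc 3 (Or.inl rfl)
    · exact hc 4 (Or.inr rfl)

end ParityType

/-! ### Uniqueness of the decomposition -/

section Uniqueness

variable {F : Type u} [Field F] [Fintype F]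

/-- The weight function of a code. -/
noncomputable def codeWeight {ι : Type*} (C : Submodule F (ι → F)) (c : C) : ℕ := wt (c : ι → F)

lemma Block.code_weight_ge {Δ a : ℕ} (hΔ : 0 < Δ) (ha : Fintype.card F ^ a ∣ Δ) {b : Block}
    (hb : b.IsAdmissible (Fintype.card F) a) (c : b.code F Δ) (hc : c ≠ 0) :
    Δ ≤ codeWeight (b.code F Δ) c := by
  have hc' : (c : b.Pos F × Fin (b.repetitions (Fintype.card F) Δ) → F) ≠ 0 := by simpa using hc
  cases b with
  | simplex k => exact ((Block.simplex_code_spec hΔ ha hb).2 c c.2 hc').ge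
  | reedMuller k =>
    obtain ⟨-, o, ho, hwo, hw⟩ := Block.reedMuller_code_spec hΔ ha hb
    by_cases h : c.1 = o
    · rw [codeWeight, h, hwo]
      omega
    · exact (hw c c.2 hc' h).ge
  | parityCheck k =>
    have hpos := Block.repetitions_pos hΔ ha hb
    obtain ⟨hq, h1, -⟩ := hb
    obtain ⟨h, rfl⟩ : 2 ∣ Δ :=
      (dvd_pow_self 2 (by omega : a ≠ 0)).trans (hq ▸ ha)
    obtain ⟨d, rfl⟩ := (repetitionEquiv hpos (parityCheckCode F k)).surjective c
    have hd : d ≠ 0 := by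
      rintro rfl
      exact hc (map_zero _)
    have hwd : 2 ≤ wt (d : ULift.{u} (Fin (k + 1)) → F) := by
      have hd0 : (d : ULift.{u} (Fin (k + 1)) → F) ≠ 0 := by simpa using hd
      by_contra h2
      have h3 := wt_pos.2 hd0
      obtain ⟨i, hi⟩ := Set.ncard_eq_one.1
        (show (Function.support (d : ULift.{u} (Fin (k + 1)) → F)).ncard = 1 from by
          change wt _ = 1
          omega)
      have h4 : ∑ j, (d : ULift.{u} (Fin (k + 1)) → F) j = d.1 i :=
        Finset.sum_eq_single i (fun j _ hj => by
          by_contra h5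
          have h6 : j ∈ Function.support (d : ULift.{u} (Fin (k + 1)) → F) := h5
          rw [hi] at h6
          exact hj h6) (by simp)
      rw [mem_parityCheckCode.1 d.2] at h4
      have h7 : i ∈ Function.support (d : ULift.{u} (Fin (k + 1)) → F) := by
        rw [hi]
        exact rfl
      exact h7 h4.symm
    have hrep : (Block.parityCheck k).repetitions (Fintype.card F) (2 * h) = h :=
      Nat.mul_div_cancel_left h two_pos
    calc 2 * h = h * 2 := mul_comm _ _
      _ ≤ h * wt (d : ULift.{u} (Fin (k + 1)) → F) := Nat.mul_le_mul_left _ hwd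
      _ = _ := ((wt_repetitionEquiv hpos _ d).trans
        (congrArg (· * wt (d : ULift.{u} (Fin (k + 1)) → F)) hrep)).symm

/-- All words of weight `Δ` of a building block have the type of that block. -/
lemma Block.wordType_code {Δ a : ℕ} (hΔ : 0 < Δ) (ha : Fintype.card F ^ a ∣ Δ) {b : Block}
    (hb : b.IsAdmissible (Fintype.card F) a) (v : b.code F Δ)
    (hv : codeWeight (b.code F Δ) v = Δ) :
    wordType (codeWeight (b.code F Δ)) Δ v = b.type (Fintype.card F) := by
  cases b with
  | simplex k =>
    obtain ⟨hc, hw⟩ := Block.simplex_code_spec hΔ ha hb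
    rw [wordType_of_constant_weight (w := codeWeight ((Block.simplex k).code F Δ)) hΔ wt_zero
      fun c h => hw c c.2 (by simpa using h), hc]
    rfl
  | reedMuller k =>
    obtain ⟨hc, o, ho, hwo, hw⟩ := Block.reedMuller_code_spec hΔ ha hb
    rw [wordType_of_one_exception (w := codeWeight ((Block.reedMuller k).code F Δ)) hΔ wt_zero
      (o := ⟨o, ho⟩) ?_ hwo
      (fun c h1 h2 => hw c c.2 (by simpa using h1) fun h => h2 (Subtype.ext h)) ?_, hc]
    · rw [Block.type, hb.1]
    · intro h
      rw [show o = 0 from congrArg Subtype.val h, wt_zero] at hwo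
      omega
    · rw [hc]
      exact (show 2 ^ 2 < 2 ^ 3 by norm_num).trans_le (Nat.pow_le_pow_right two_pos hb.2.1)
  | parityCheck k =>
    have hpos := Block.repetitions_pos hΔ ha hb
    obtain ⟨hq, h1, hk⟩ := hb
    obtain ⟨h, rfl⟩ : 2 ∣ Δ :=
      (dvd_pow_self 2 (by omega : a ≠ 0)).trans (hq ▸ ha)
    have hrep : (Block.parityCheck k).repetitions (Fintype.card F) (2 * h) = h :=
      Nat.mul_div_cancel_left h two_pos
    obtain ⟨d, rfl⟩ := (repetitionEquiv hpos (parityCheckCode F k)).surjective v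
    have hw : ∀ d : parityCheckCode F k, codeWeight ((Block.parityCheck k).code F (2 * h))
        ((repetitionEquiv hpos (parityCheckCode F k)).toAddEquiv d)
          = h * wt (d : ULift.{u} (Fin (k + 1)) → F) := fun d =>
      (wt_repetitionEquiv hpos _ d).trans
        (congrArg (· * wt (d : ULift.{u} (Fin (k + 1)) → F)) hrep)
    have hd : wt (d : ULift.{u} (Fin (k + 1)) → F) = 2 := by
      have h2 := (hw d).symm.trans hv
      rw [mul_comm 2 h] at h2
      exact Nat.eq_of_mul_eq_mul_left (by omega) h2
    exact (wordType_addEquiv (2 * h) _ hw d).trans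
      (wordType_parityCheckCode hq hk (by omega) d hd)

lemma Block.exists_codeWeight_eq {Δ a : ℕ} (hΔ : 0 < Δ) (ha : Fintype.card F ^ a ∣ Δ) {b : Block}
    (hb : b.IsAdmissible (Fintype.card F) a) : ∃ v : b.code F Δ, codeWeight (b.code F Δ) v = Δ := by
  cases b with
  | simplex k =>
    obtain ⟨hc, hw⟩ := Block.simplex_code_spec hΔ ha hb
    have h1 : 1 < Nat.card ((Block.simplex k).code F Δ) := by
      rw [hc]
      exact Nat.one_lt_pow (by have := hb.1; omega) Fintype.one_lt_card
    have := Finite.one_lt_card_iff_nontrivial.1 h1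
    obtain ⟨v, hv⟩ := exists_ne (0 : (Block.simplex k).code F Δ)
    exact ⟨v, hw v v.2 (by simpa using hv)⟩
  | reedMuller k =>
    obtain ⟨hc, o, ho, hwo, hw⟩ := Block.reedMuller_code_spec hΔ ha hb
    have h1 : 4 < Nat.card ((Block.reedMuller k).code F Δ) := by
      rw [hc]
      exact (show 2 ^ 2 < 2 ^ 3 by norm_num).trans_le (Nat.pow_le_pow_right two_pos hb.2.1)
    have h2 : ({0, ⟨o, ho⟩} : Set ((Block.reedMuller k).code F Δ)).ncard <
        Nat.card ((Block.reedMuller k).code F Δ) := by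
      have h3 := Set.ncard_insert_le (0 : (Block.reedMuller k).code F Δ) {⟨o, ho⟩}
      rw [Set.ncard_singleton] at h3
      exact lt_of_le_of_lt h3 (lt_trans (by norm_num) h1)
    obtain ⟨v, hv⟩ : ∃ v, v ∉ ({0, ⟨o, ho⟩} : Set ((Block.reedMuller k).code F Δ)) := by
      by_contra! h
      rw [Set.eq_univ_of_forall h, Set.ncard_univ] at h2
      exact lt_irrefl _ h2
    simp only [Set.mem_insert_iff, Set.mem_singleton_iff, not_or] at hv
    exact ⟨v, hw v v.2 (by simpa using hv.1) fun h => hv.2 (Subtype.ext h)⟩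
  | parityCheck k =>
    have hpos := Block.repetitions_pos hΔ ha hb
    obtain ⟨hq, h1, hk⟩ := hb
    obtain ⟨h, rfl⟩ : 2 ∣ Δ :=
      (dvd_pow_self 2 (by omega : a ≠ 0)).trans (hq ▸ ha)
    have hrep : (Block.parityCheck k).repetitions (Fintype.card F) (2 * h) = h :=
      Nat.mul_div_cancel_left h two_pos
    have : Nontrivial (Fin (k + 1)) := Fin.nontrivial_iff_two_le.2 (by omega)
    obtain ⟨i, j, hij⟩ := exists_pair_ne (ULift.{u} (Fin (k + 1)))
    refine ⟨repetitionEquiv hpos (parityCheckCode F k) ⟨pairWord i j, pairWord_mem i j⟩, ?_⟩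
    refine (wt_repetitionEquiv hpos _ _).trans ?_
    exact (congrArg₂ (· * ·) hrep (wt_pairWord hij)).trans (mul_comm h 2)

lemma Block.typeCount_code {Δ a : ℕ} (hΔ : 0 < Δ) (ha : Fintype.card F ^ a ∣ Δ) {b b' : Block}
    (hb : b.IsAdmissible (Fintype.card F) a) :
    (typeCount (codeWeight (b.code F Δ)) Δ (b'.type (Fintype.card F)) ≠ 0) ↔ b = b' := by
  constructor
  · intro h
    have : Nonempty {v // codeWeight (b.code F Δ) v = Δ ∧
        wordType (codeWeight (b.code F Δ)) Δ v = b'.type (Fintype.card F)} := by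
      by_contra hne
      rw [not_nonempty_iff] at hne
      exact h (Nat.card_of_isEmpty)
    obtain ⟨v, hv, hv'⟩ := this
    rw [Block.wordType_code hΔ ha hb v hv] at hv'
    exact Block.type_injective Fintype.one_lt_card hv'
  · rintro rfl
    obtain ⟨v, hv⟩ := Block.exists_codeWeight_eq hΔ ha hb
    have : Nonempty {v // codeWeight (b.code F Δ) v = Δ ∧
        wordType (codeWeight (b.code F Δ)) Δ v = b.type (Fintype.card F)} :=
      ⟨v, hv, Block.wordType_code hΔ ha hb v hv⟩
    exact Nat.card_pos.ne'

omit [Fintype F] in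
/-- A semimonomial transformation is additive and preserves weights. -/
lemma exists_addEquiv_of_codeIso {ι κ : Type*} {C : Submodule F (ι → F)} {D : Submodule F (κ → F)}
    (h : CodeIso C D) : ∃ f : C ≃+ D, ∀ c, codeWeight D (f c) = codeWeight C c := by
  obtain ⟨e, u, σ, h⟩ := h
  let T : (ι → F) → κ → F := fun c k => u (e.symm k) * σ (c (e.symm k))
  have hT : ∀ c i, T c (e i) = u i * σ (c i) := fun c i => by simp [T]
  have hmem : ∀ c ∈ C, T c ∈ D := fun c hc => (h _).2 ⟨c, hc, hT c⟩
  let f : C →+ D :=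
    { toFun := fun c => ⟨T c, hmem c c.2⟩
      map_zero' := by
        ext k
        simp [T]
      map_add' := fun c c' => by
        ext k
        simp [T, mul_add] }
  refine ⟨AddEquiv.ofBijective f ⟨?_, ?_⟩, fun c => ?_⟩
  · refine (injective_iff_map_eq_zero f).2 fun c hc => ?_
    ext i
    have h1 : T c (e i) = 0 := congrFun (congrArg Subtype.val hc) (e i)
    rw [hT] at h1
    simpa using h1
  · rintro ⟨d, hd⟩
    obtain ⟨c, hc, hcd⟩ := (h d).1 hd
    refine ⟨⟨c, hc⟩, Subtype.ext (funext fun k => ?_)⟩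
    obtain ⟨i, rfl⟩ := e.surjective k
    exact (hT c i).trans (hcd i).symm
  · refine (wt_congr e _ _ fun i => ?_).symm
    change (c : ι → F) i ≠ 0 ↔ T c (e i) ≠ 0
    rw [hT]
    simp

/-- The words of `extendByZeros z D` are those of `D`. -/
noncomputable def extendEquiv {κ : Type*} (z : ℕ) (D : Submodule F (κ → F)) :
    D ≃+ extendByZeros z D where
  toFun d := ⟨extendMap z D d, mem_extendByZeros.2 ⟨d.2, fun _ => rfl⟩⟩
  invFun c := ⟨fun j => c.1 (Sum.inl j), (mem_extendByZeros.1 c.2).1⟩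
  left_inv _ := rfl
  right_inv c := by
    ext (j | j)
    · rfl
    · exact ((mem_extendByZeros.1 c.2).2 j).symm
  map_add' d d' := Subtype.ext (map_add (extendMap z D) d d')

lemma typeCount_eq_sum_of_isDirectSumOfBlocks {ι : Type*} {Δ a : ℕ} (hΔ : 0 < Δ)
    (ha : Fintype.card F ^ a ∣ Δ) {C : Submodule F (ι → F)} {s : ℕ} {b : Fin s → Block}
    (hb : ∀ i, (b i).IsAdmissible (Fintype.card F) a) (h : IsDirectSumOfBlocks Δ C b)
    (τ : ℕ × ℕ) :
    typeCount (codeWeight C) Δ τ = ∑ i, typeCount (codeWeight ((b i).code F Δ)) Δ τ := by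
  obtain ⟨z, hz⟩ := h
  obtain ⟨f, hf⟩ := exists_addEquiv_of_codeIso hz
  rw [typeCount_addEquiv Δ f hf,
    ← typeCount_addEquiv Δ (extendEquiv z _) fun d => wt_extendMap z _ d,
    ← typeCount_pi hΔ (fun i => wt_zero) fun i => Block.code_weight_ge hΔ ha (hb i)]
  exact typeCount_addEquiv Δ (directSumEquiv _).toAddEquiv
    (fun d => (wt_eq_sum_wt_directSumEquiv _ d).symm) τ

/-- The number of summands equal to a given block is determined by the code: it is the number of
words of weight `Δ` of the type of the block, divided by their number in a single block. -/
theorem exists_equiv_of_isDirectSumOfBlocks {ι : Type*} {Δ a : ℕ} (hΔ : 0 < Δ)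
    (ha : Fintype.card F ^ a ∣ Δ) {C : Submodule F (ι → F)} {s t : ℕ} {b : Fin s → Block}
    {b' : Fin t → Block} (hb : ∀ i, (b i).IsAdmissible (Fintype.card F) a)
    (hb' : ∀ i, (b' i).IsAdmissible (Fintype.card F) a) (h : IsDirectSumOfBlocks Δ C b)
    (h' : IsDirectSumOfBlocks Δ C b') : ∃ e : Fin s ≃ Fin t, ∀ i, b' (e i) = b i := by
  classical
  refine exists_equiv_of_natCard_fiber_eq b b' fun β => ?_
  by_cases hβ : β.IsAdmissible (Fintype.card F) a
  · set M := typeCount (codeWeight (β.code F Δ)) Δ (β.type (Fintype.card F)) with hM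
    have hM0 : 0 < M := Nat.pos_of_ne_zero ((Block.typeCount_code hΔ ha hβ).2 rfl)
    have key : ∀ {r : ℕ} (c : Fin r → Block), (∀ i, (c i).IsAdmissible (Fintype.card F) a) →
        IsDirectSumOfBlocks Δ C c →
          typeCount (codeWeight C) Δ (β.type (Fintype.card F)) = Nat.card {i // c i = β} * M := by
      intro r c hc hC
      rw [typeCount_eq_sum_of_isDirectSumOfBlocks hΔ ha hc hC]
      have h1 : ∀ i, typeCount (codeWeight ((c i).code F Δ)) Δ (β.type (Fintype.card F))
          = if c i = β then M else 0 := by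
        intro i
        split_ifs with hi
        · rw [hi]
        · by_contra h2
          exact hi ((Block.typeCount_code hΔ ha (hc i)).1 h2)
      rw [Finset.sum_congr rfl fun i _ => h1 i, ← Finset.sum_filter, Finset.sum_const, smul_eq_mul,
        Nat.card_eq_fintype_card, Fintype.card_subtype]
    exact Nat.eq_of_mul_eq_mul_right hM0 ((key b hb h).symm.trans (key b' hb' h'))
  · have h1 : IsEmpty {i // b i = β} := ⟨fun i => hβ (i.2 ▸ hb i.1)⟩
    have h2 : IsEmpty {i // b' i = β} := ⟨fun i => hβ (i.2 ▸ hb' i.1)⟩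
    simp

end Uniqueness

end DivisibleCodes

theorem mainTheorem1 {F : Type*} [Field F] [Fintype F] [DecidableEq F]
    (Δ a n : ℕ) (hΔ : 0 < Δ)
    (ha : IsGreatest {m : ℕ | Fintype.card F ^ m ∣ Δ} a)
    (C : Submodule F (Fin n → F))
    (hdiv : DivisibleCodes.IsDivisible Δ C)
    (hspan : DivisibleCodes.IsSpannedByWeight Δ C) :
    (∃ (s : ℕ) (b : Fin s → DivisibleCodes.Block),
      (∀ i, (b i).IsAdmissible (Fintype.card F) a) ∧
        DivisibleCodes.IsDirectSumOfBlocks Δ C b) ∧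
    (∀ (s t : ℕ) (b : Fin s → DivisibleCodes.Block) (b' : Fin t → DivisibleCodes.Block),
      (∀ i, (b i).IsAdmissible (Fintype.card F) a) →
      (∀ i, (b' i).IsAdmissible (Fintype.card F) a) →
      DivisibleCodes.IsDirectSumOfBlocks Δ C b →
      DivisibleCodes.IsDirectSumOfBlocks Δ C b' →
      ∃ e : Fin s ≃ Fin t, ∀ i, b' (e i) = b i) := by
  refine ⟨?_, fun s t b b' hb hb' h h' =>
    DivisibleCodes.exists_equiv_of_isDirectSumOfBlocks hΔ ha.1 hb hb' h h'⟩
  refine DivisibleCodes.exists_isDirectSumOfBlocks hΔ ha (fun c hc => ?_) ?_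
  · rw [DivisibleCodes.wt_eq_hammingNorm]
    exact hdiv c hc
  · have hmin : DivisibleCodes.minWords Δ C = {c | c ∈ C ∧ hammingNorm c = Δ} := by
      ext c
      simp only [DivisibleCodes.minWords, DivisibleCodes.wt_eq_hammingNorm]
    rw [hmin]
    exact hspan
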